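/- **Setting.** Fix known reals $\underline Y,\overline Y$ and $d=d_X$. A unit is $(Y^*,D,X)$ with law $P$ on $\mathbb R\times\{0,1\}\times\mathbb R^{d}$, where $\underline Y\le Y^*\le\overline Y$ $P$-a.s. and $Y^*$ is independent of $X$. One observes $n$ i.i.d. copies of $(Y,D,X)$, $Y=Y^*D$. Put $W^L=YD+\underline Y(1-D)$, $W^H=YD+\overline Y(1-D)$, $m(W,\theta)=(\theta-W^L,\,W^H-\theta)$, and for a parameter set $\Theta\subseteq\mathbb R$ let $\Theta_0(P)=\{\theta\in\Theta: E_P[m(W,\theta)\mid X]\ge 0\ P\text{-a.s.}\}$ be the identified set for the mean of $Y^*$. Let $\mathcal P$ be a class of such laws. Let $\mathcal G$ be a class of measurable functions $g=(g_1,g_2):\mathbb R^d\to\mathbb R^2$ that has a countable subclass whose pointwise sequential limits exhaust $\mathcal G$, and let $S:\mathbb R^2\to[0,\infty)$. With $E_n$ the sample mean, $\hat\mu_{n,j}(\theta,g)=E_n m_j(W_i,\theta)g_j(X_i)$, $\hat\sigma_{n,j}(\theta,g)=\{E_n[m_j(W_i,\theta)g_j(X_i)]^2-\hat\mu_{n,j}(\theta,g)^2\}^{1/2}$,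 and (possibly data dependent) $\sigma_n,\hat c_n$, let $$T_n(\theta)=\sup_{g\in\mathcal G}S\Big(\tfrac{\hat\mu_{n,1}(\theta,g)}{\hat\sigma_{n,1}(\theta,g)\vee\sigma_n},\tfrac{\hat\mu_{n,2}(\theta,g)}{\hat\sigma_{n,2}(\theta,g)\vee\sigma_n}\Big),\qquad \mathcal C_n(\hat c_n)=\Big\{\theta\in\Theta:\tfrac{\sqrt n}{\sqrt{\log n}}T_n(\theta)\le\hat c_n\Big\},$$ and let $d_H$ be the Hausdorff distance on subsets of $\mathbb R$. "W.p.a.1" means with probability tending to one uniformly in $P\in\mathcal P$. **Conditions.** (a) $g_j(X)\ge0$ $P$-a.s. for all $P\in\mathcal P$, $g\in\mathcal G$, $j$. (b) $|m_j(W,\theta)g_j(X)|\le\overline M$ $P$-a.s. for all $P\in\mathcal P$, $\theta\in\Theta$, $g\in\mathcal G$, $j$. (c) For $j=1,2$, the class $\{s\,m_j(W,\theta)g_j(X)+t:\theta\in\Theta,\ g\in\mathcal G,\ |s|,|t|\le\overline M\vee1\}$ and the class of squares of its members have $\sup_QN(\varepsilon,\cdot,L_1(Q))\le A\varepsilon^{-V}$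 for $0<\varepsilon<1$, for some $A,V>0$, with $Q$ ranging over all probability laws of $(Y,D,X)$ under which $W^L,W^H\in[\underline Y,\overline Y]$. (d) $S(t)>0$ iff some $t_j<0$; and for some $K_{S,1},K_{S,2}>0$ and all $c>0$: $S(t)\ge c$ implies $t_j\le -cK_{S,1}$ for some $j$, and $S(t)\le c$ implies $t_j\ge -cK_{S,2}$ for all $j$. (e) For some constant, $\sigma_n$ is at most that constant w.p.a.1; $\sigma_n\sqrt{n/\log n}\ge\hat a_n$ for $n\ge2$, for some (possibly data dependent) $\hat a_n$; and $\hat a_n\ge K$ and $\hat c_n\ge K$ w.p.a.1. (f) $\mathcal G$ is uniformly bounded, and for some $C_1,C_2\in(0,1)$ and every $s\in\mathbb R^d$, $t>0$ there is $g\in\mathcal G$ with $C_1I(\|x-s\|<C_2t)\le g_j(x)\le I(\|x-s\|<t)$ for all $x$ and $j$. **Theorem.** There is $K_0>0$, depending only on $V,\overline M,K_{S,1}$, such that if (a)-(f) hold with some $K\ge K_0$, then the following holds. Suppose that for every $P\in\mathcal P$ the identified set is a nonempty interval $\Theta_0(P)=[\underline\gamma,\overline\gamma]$ (depending on $P$).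 1. (Finite point.) Let $\phi_m>0$, $\phi_x>-1$, $C,\eta>0$ be constants such that for every $P\in\mathcal P$ there is $x_0\in\mathbb R^d$ such that, for $x_0-\eta\iota\le x\le x_0$ (elementwise, $\iota=(1,\dots,1)$), $E_P(W^H|X=x)-\overline\gamma\le C\|x_0-x\|^{\phi_m}$ and $X$ has a density there with $f_X(x)\ge\prod_k|x_{0,k}-x_k|^{\phi_x}/C$, and the same holds with $\underline\gamma-W^L$ in place of $W^H-\overline\gamma$ for a possibly different $x_0$. Let $\alpha=\phi_m/(\phi_x+1)$. If $\sigma_n(n/\log n)^{\psi/2}$ with $\psi=d/(d+2\alpha)$ is bounded by some constant w.p.a.1, then for some $B$ $$\sup_{P\in\mathcal P}P\Big(\Big(\frac n{\hat c_n^2\log n}\Big)^{\alpha/(d+2\alpha)}d_H(\mathcal C_n(\hat c_n),\Theta_0(P))>B\Big)\to0 .$$ 2. (Infinity.) Let $d=1$ and let $\phi_m>0$, $\phi_x>1$, $C,K_X>0$ be constants such that for every $P\in\mathcal P$ and all $x\ge K_X$, $E_P(W^H|X=x)-\overline\gamma\le Cx^{-\phi_m}$, $\underline\gamma-E_P(W^L|X=x)\le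 Cx^{-\phi_m}$, and $X$ has a density there with $f_X(x)\ge x^{-\phi_x}/C$. Let $\alpha=\phi_m/(\phi_x-1)$. If $\sigma_n(n/\log n)^{\psi/2}$ with $\psi=d/(d+2\alpha)$ is bounded by some constant w.p.a.1, then the conclusion of 1 holds with this $\alpha$. 3. (Positive probability.) Suppose that there are a box $[\underline x,\overline x]\subset\mathbb R^d$ and $\eta,p>0$ such that for all $P\in\mathcal P$, $E_P(W^H|X)=\overline\gamma$ a.s. on $\{\underline x\le X\le\overline x\}$ and $P(\underline x+\eta\iota\le X\le\overline x-\eta\iota)\ge p$, and that the same holds with $E_P(W^L|X)=\underline\gamma$ for a possibly different box. Then for some $B$ $$\sup_{P\in\mathcal P}P\Big(\Big(\frac n{\hat c_n^2\log n}\Big)^{1/2}d_H(\mathcal C_n(\hat c_n),\Theta_0(P))>B\Big)\to0 .$$ -/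

import Mathlib

open MeasureTheory ProbabilityTheory Filter Topology
open scoped ENNReal

namespace SelectionKS

noncomputable section

/-- `ℝ^d` with its Euclidean norm. -/
abbrev Euc (d : ℕ) : Type := EuclideanSpace ℝ (Fin d)

/-- A population unit `(Y*, D, X)`: latent outcome, selection indicator, conditioning variable. -/
abbrev Latent (d : ℕ) : Type := ℝ × Bool × Euc d

/-- An observation `(Y, D, X)`. -/
abbrev Obs (d : ℕ) : Type := ℝ × Bool × Euc d

/-- What is observed of a unit: `(Y, D, X)` with `Y = Y* · D`. -/
def observe {d : ℕ} (u : Latent d) : Obs d := (if u.2.1 then u.1 else 0, u.2.1, u.2.2)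

/-- The conditioning variable `X` of an observation. -/
def Obs.X {d : ℕ} (o : Obs d) : Euc d := o.2.2

/-- `Y · D + w · (1 - D)`; it is `W^L` for `w = ylo` and `W^H` for `w = yhi`. -/
def fill {d : ℕ} (w : ℝ) (o : Obs d) : ℝ := if o.2.1 then o.1 else w

/-- The law of one observation when `P` is the law of `(Y*, D, X)`. -/
def obsLaw {d : ℕ} (P : Measure (Latent d)) : Measure (Obs d) := P.map observe

/-- The law of `n` independent observations when `P` is the law of `(Y*, D, X)`. -/
def sampleLaw {d : ℕ} (P : Measure (Latent d)) (n : ℕ) : Measure (Fin n → Obs d) :=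
  Measure.pi fun _ => obsLaw P

/-- The selection model: the latent outcome lies in `[ylo, yhi]` and is independent of `X`. -/
structure IsSelectionModel {d : ℕ} (ylo yhi : ℝ) (P : Measure (Latent d)) : Prop where
  prob : IsProbabilityMeasure P
  bounded : ∀ᵐ u ∂P, ylo ≤ u.1 ∧ u.1 ≤ yhi
  exogenous : IndepFun (fun u : Latent d => u.1) (fun u : Latent d => u.2.2) P

/-- The moment function `m(W, θ) = (θ - W^L, W^H - θ)`. -/
def moment {d : ℕ} (ylo yhi : ℝ) (j : Fin 2) (θ : ℝ) (o : Obs d) : ℝ :=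
  if j = 0 then θ - fill ylo o else fill yhi o - θ

/-- (A version of) `E[f | X]`, as a function of the observation. -/
def condX {d : ℕ} (R : Measure (Obs d)) (f : Obs d → ℝ) : Obs d → ℝ :=
  R[f | MeasurableSpace.comap (Obs.X (d := d)) inferInstance]

/-- The identified set: all `θ ∈ Θ` with `E[m(W, θ) | X] ≥ 0` almost surely. -/
def identifiedSet {d : ℕ} (ylo yhi : ℝ) (Θ : Set ℝ) (P : Measure (Latent d)) : Set ℝ :=
  {θ ∈ Θ | ∀ j, ∀ᵐ o ∂(obsLaw P), 0 ≤ condX (obsLaw P) (moment ylo yhi j θ) o}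

/-! ### The variance-weighted KS statistic and the confidence region -/

/-- The sample mean `E_n f`. -/
def sampleMean {d n : ℕ} (o : Fin n → Obs d) (f : Obs d → ℝ) : ℝ := (∑ i, f (o i)) / n

/-- `m_j(W, θ) g_j(X)`. -/
def weighted {d : ℕ} (ylo yhi : ℝ) (θ : ℝ) (g : Euc d → Fin 2 → ℝ) (j : Fin 2) (o : Obs d) : ℝ :=
  moment ylo yhi j θ o * g o.X j

/-- The sample mean of `m_j(W, θ) g_j(X)`. -/
def muHat {d n : ℕ} (ylo yhi : ℝ) (o : Fin n → Obs d) (θ : ℝ) (g : Euc d → Fin 2 → ℝ)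
    (j : Fin 2) : ℝ :=
  sampleMean o (weighted ylo yhi θ g j)

/-- The sample standard deviation of `m_j(W, θ) g_j(X)`. -/
def sigmaHat {d n : ℕ} (ylo yhi : ℝ) (o : Fin n → Obs d) (θ : ℝ) (g : Euc d → Fin 2 → ℝ)
    (j : Fin 2) : ℝ :=
  √(sampleMean o (fun z => weighted ylo yhi θ g j z ^ 2)
    - sampleMean o (weighted ylo yhi θ g j) ^ 2)

/-- The KS statistic `T_n(θ)` with truncation point `σ`, a supremum in the extended reals. -/
def ksStat {d n : ℕ} (ylo yhi : ℝ) (𝒢 : Set (Euc d → Fin 2 → ℝ)) (S : (Fin 2 → ℝ) → ℝ)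
    (σ : ℝ) (o : Fin n → Obs d) (θ : ℝ) : EReal :=
  ⨆ g ∈ 𝒢, ((S fun j => muHat ylo yhi o θ g j / max (sigmaHat ylo yhi o θ g j) σ : ℝ) : EReal)

/-- The region of all `θ ∈ Θ` with `(√n / √(log n)) T_n(θ) ≤ c`. -/
def ksRegion {d n : ℕ} (ylo yhi : ℝ) (Θ : Set ℝ) (𝒢 : Set (Euc d → Fin 2 → ℝ))
    (S : (Fin 2 → ℝ) → ℝ) (σ c : ℝ) (o : Fin n → Obs d) : Set ℝ :=
  {θ ∈ Θ | ((√n / √(Real.log n) : ℝ) : EReal) * ksStat ylo yhi 𝒢 S σ o θ ≤ (c : EReal)}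

/-! ### Uniformity in the underlying distribution -/

/-- The events `E n` have probability tending to one, uniformly in `P ∈ 𝓜`. -/
def UnifProbToOne {d : ℕ} (𝓜 : Set (Measure (Latent d))) (E : ∀ n, Set (Fin n → Obs d)) : Prop :=
  Tendsto (fun n => ⨆ P ∈ 𝓜, sampleLaw P n (E n)ᶜ) atTop (𝓝 0)

/-- `sup_{P ∈ 𝓜} P((n / (c_n² log n))^ρ d_H(C_n(c_n), Θ₀(P)) > B) → 0` for some `B`, where `d_H`
is the (extended) Hausdorff distance. -/
def ConvergesAtRate {d : ℕ} (ylo yhi : ℝ) (Θ : Set ℝ) (𝓜 : Set (Measure (Latent d)))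
    (𝒢 : Set (Euc d → Fin 2 → ℝ)) (S : (Fin 2 → ℝ) → ℝ)
    (σ c : ∀ n : ℕ, (Fin n → Obs d) → ℝ) (ρ : ℝ) : Prop :=
  ∃ B : ℝ, Tendsto (fun n : ℕ => ⨆ P ∈ 𝓜, sampleLaw P n
      {o | ENNReal.ofReal B <
        ENNReal.ofReal (((n : ℝ) / (c n o ^ 2 * Real.log n)) ^ ρ) *
          Metric.hausdorffEDist (ksRegion ylo yhi Θ 𝒢 S (σ n o) (c n o) o)
            (identifiedSet ylo yhi Θ P)})
    atTop (𝓝 0)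

/-! ### Conditions on the instruments, on `S` and on the tuning sequences -/

/-- Measurability of the class: every instrument is measurable, and there is a countable subclass
whose pointwise sequential limits exhaust the class. -/
def PointwiseMeasurable {d : ℕ} (𝒢 : Set (Euc d → Fin 2 → ℝ)) : Prop :=
  (∀ g ∈ 𝒢, Measurable g) ∧
  ∃ 𝒢₀ ⊆ 𝒢, 𝒢₀.Countable ∧ ∀ g ∈ 𝒢, ∃ u : ℕ → Euc d → Fin 2 → ℝ,
    (∀ k, u k ∈ 𝒢₀) ∧ ∀ x, Tendsto (fun k => u k x) atTop (𝓝 (g x))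

/-- `g_j(X) ≥ 0` almost surely. -/
def NonnegInstruments {d : ℕ} (𝓜 : Set (Measure (Latent d)))
    (𝒢 : Set (Euc d → Fin 2 → ℝ)) : Prop :=
  ∀ P ∈ 𝓜, ∀ g ∈ 𝒢, ∀ j, ∀ᵐ o ∂(obsLaw P), 0 ≤ g o.X j

/-- `|m_j(W, θ) g_j(X)| ≤ Ybar` almost surely. -/
def BoundedMoments {d : ℕ} (ylo yhi : ℝ) (Θ : Set ℝ) (𝓜 : Set (Measure (Latent d)))
    (𝒢 : Set (Euc d → Fin 2 → ℝ)) (Ybar : ℝ) : Prop :=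
  ∀ P ∈ 𝓜, ∀ θ ∈ Θ, ∀ g ∈ 𝒢, ∀ j, ∀ᵐ o ∂(obsLaw P), |weighted ylo yhi θ g j o| ≤ Ybar

/-- The `L₁(Q)` covering number: the least number of `Q`-integrable functions (not necessarily in
the class) such that every member of the class is within `ε` of one of them (`⊤` if there is no
finite such family). -/
def coveringNumber {Z : Type*} [MeasurableSpace Z] (ε : ℝ) (F : Set (Z → ℝ)) (Q : Measure Z) :
    ℕ∞ :=
  ⨅ (s : Finset (Z → ℝ)) (_ : (∀ h ∈ s, Integrable h Q) ∧
    ∀ f ∈ F, ∃ h ∈ s, ∫⁻ z, ‖f z - h z‖ₑ ∂Q ≤ ENNReal.ofReal ε), (s.card : ℕ∞)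

/-- The functions `s m_j(W, θ) g_j(X) + t` with `|s|, |t| ≤ Ybar ∨ 1`. -/
def affineClass {d : ℕ} (ylo yhi : ℝ) (Θ : Set ℝ) (𝒢 : Set (Euc d → Fin 2 → ℝ)) (Ybar : ℝ)
    (j : Fin 2) : Set (Obs d → ℝ) :=
  {f | ∃ θ ∈ Θ, ∃ g ∈ 𝒢, ∃ s t : ℝ, |s| ≤ max Ybar 1 ∧ |t| ≤ max Ybar 1 ∧
    f = fun o => s * weighted ylo yhi θ g j o + t}

/-- The squares of the functions in `affineClass`. -/
def squareClass {d : ℕ} (ylo yhi : ℝ) (Θ : Set ℝ) (𝒢 : Set (Euc d → Fin 2 → ℝ)) (Ybar : ℝ)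
    (j : Fin 2) : Set (Obs d → ℝ) :=
  {f | ∃ h ∈ affineClass ylo yhi Θ 𝒢 Ybar j, f = fun o => h o ^ 2}

/-- The uniform covering number bound `sup_Q N(ε, F, L₁(Q)) ≤ A ε^(-V)`, `0 < ε < 1`, for both
classes; `Q` ranges over all probability measures under which the outcomes are in the known range
`[ylo, yhi]`. -/
def PolynomialCovering {d : ℕ} (ylo yhi : ℝ) (Θ : Set ℝ) (𝒢 : Set (Euc d → Fin 2 → ℝ))
    (Ybar A V : ℝ) : Prop :=
  ∀ j : Fin 2, ∀ F ∈ ({affineClass ylo yhi Θ 𝒢 Ybar j, squareClass ylo yhi Θ 𝒢 Ybar j} :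
      Set (Set (Obs d → ℝ))),
    ∀ Q : Measure (Obs d), IsProbabilityMeasure Q →
      (∀ᵐ o ∂Q, fill ylo o ∈ Set.Icc ylo yhi ∧ fill yhi o ∈ Set.Icc ylo yhi) →
      ∀ ε : ℝ, 0 < ε → ε < 1 →
        ((coveringNumber ε F Q : ℕ∞) : ℝ≥0∞) ≤ ENNReal.ofReal (A * ε ^ (-V))

/-- The condition on `S : ℝ² → ℝ₊`, with constants `K₁` and `K₂`. -/
structure SCondition (S : (Fin 2 → ℝ) → ℝ) (K₁ K₂ : ℝ) : Prop where
  nonneg : ∀ t, 0 ≤ S t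
  pos_iff : ∀ t, 0 < S t ↔ ∃ j, t j < 0
  lower : ∀ c > 0, ∀ t, c ≤ S t → ∃ j, t j ≤ -(c * K₁)
  upper : ∀ c > 0, ∀ t, S t ≤ c → ∀ j, -(c * K₂) ≤ t j

/-- `𝒢` is uniformly bounded and contains, for each ball, a function comparable to its
indicator. -/
def RichInstruments {d : ℕ} (𝒢 : Set (Euc d → Fin 2 → ℝ)) : Prop :=
  (∃ M : ℝ, ∀ g ∈ 𝒢, ∀ x j, |g x j| ≤ M) ∧
  ∃ C₁ C₂ : ℝ, 0 < C₁ ∧ C₁ < 1 ∧ 0 < C₂ ∧ C₂ < 1 ∧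
    ∀ (s : Euc d) (t : ℝ), 0 < t → ∃ g ∈ 𝒢, ∀ x j,
      (Metric.ball s (C₂ * t)).indicator (fun _ => C₁) x ≤ g x j ∧
      g x j ≤ (Metric.ball s t).indicator (fun _ => (1 : ℝ)) x

/-- The truncation points `σ n` are bounded above (with probability tending to one), and
`σ_n √(n / log n) ≥ a_n`. -/
def CutoffCondition {d : ℕ} (𝓜 : Set (Measure (Latent d)))
    (σ a : ∀ n : ℕ, (Fin n → Obs d) → ℝ) : Prop :=
  (∃ M : ℝ, UnifProbToOne 𝓜 fun n => {o | σ n o ≤ M}) ∧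
  ∀ n : ℕ, 2 ≤ n → ∀ o, a n o ≤ σ n o * √((n : ℝ) / Real.log n)

/-- `σ_n (n / log n)^(ψ/2)` is bounded uniformly in `P` (with probability tending to one). -/
def CutoffRate {d : ℕ} (𝓜 : Set (Measure (Latent d)))
    (σ : ∀ n : ℕ, (Fin n → Obs d) → ℝ) (ψ : ℝ) : Prop :=
  ∃ M : ℝ, UnifProbToOne 𝓜 fun n => {o | σ n o * ((n : ℝ) / Real.log n) ^ (ψ / 2) ≤ M}

/-! ### Types of set identification -/

/-- On the region `A`, `X` has a density that is at least `l`. -/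
def HasDensityGE {d : ℕ} (R : Measure (Obs d)) (A : Set (Euc d)) (l : Euc d → ℝ) : Prop :=
  ∃ f : Euc d → ℝ≥0∞, Measurable f ∧
    (R.map Obs.X).restrict A = (volume.restrict A).withDensity f ∧
    ∀ x ∈ A, ENNReal.ofReal (l x) ≤ f x

/-- Identified set `[γl, γu]`, with polynomial identification at a finite point (possibly
different points for the upper and the lower end). -/
def IdentFinite {d : ℕ} (ylo yhi : ℝ) (Θ : Set ℝ) (φm φx C η : ℝ) (P : Measure (Latent d)) :
    Prop :=
  let box : Euc d → Set (Euc d) := fun x₀ => {x | ∀ k, x₀ k - η ≤ x k ∧ x k ≤ x₀ k}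
  ∃ γl γu : ℝ, γl ≤ γu ∧ identifiedSet ylo yhi Θ P = Set.Icc γl γu ∧
    (∃ x₀ : Euc d,
      (∀ᵐ o ∂(obsLaw P), o.X ∈ box x₀ →
        condX (obsLaw P) (fill yhi) o - γu ≤ C * ‖x₀ - o.X‖ ^ φm) ∧
      HasDensityGE (obsLaw P) (box x₀) fun x => (∏ k, |x₀ k - x k| ^ φx) / C) ∧
    (∃ x₀ : Euc d,
      (∀ᵐ o ∂(obsLaw P), o.X ∈ box x₀ →
        γl - condX (obsLaw P) (fill ylo) o ≤ C * ‖x₀ - o.X‖ ^ φm) ∧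
      HasDensityGE (obsLaw P) (box x₀) fun x => (∏ k, |x₀ k - x k| ^ φx) / C)

/-- Identified set `[γl, γu]`, with identification at infinity with polynomial tails along the
coordinate `i` (used for `d = 1`, where `i` is the only coordinate). -/
def IdentInfinity {d : ℕ} (ylo yhi : ℝ) (Θ : Set ℝ) (i : Fin d) (φm φx C KX : ℝ)
    (P : Measure (Latent d)) : Prop :=
  ∃ γl γu : ℝ, γl ≤ γu ∧ identifiedSet ylo yhi Θ P = Set.Icc γl γu ∧
    (∀ᵐ o ∂(obsLaw P), KX ≤ o.X i →
      condX (obsLaw P) (fill yhi) o - γu ≤ C * (o.X i) ^ (-φm)) ∧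
    (∀ᵐ o ∂(obsLaw P), KX ≤ o.X i →
      γl - condX (obsLaw P) (fill ylo) o ≤ C * (o.X i) ^ (-φm)) ∧
    HasDensityGE (obsLaw P) {x | KX ≤ x i} fun x => (x i) ^ (-φx) / C

/-- Identified set `[γl, γu]`, with identification on the boxes `[lH, uH]` (upper end) and
`[lL, uL]` (lower end), whose `η`-interiors have probability at least `p`. -/
def IdentPositive {d : ℕ} (ylo yhi : ℝ) (Θ : Set ℝ) (lH uH lL uL : Euc d) (η p : ℝ)
    (P : Measure (Latent d)) : Prop :=
  ∃ γl γu : ℝ, γl ≤ γu ∧ identifiedSet ylo yhi Θ P = Set.Icc γl γu ∧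
    (∀ᵐ o ∂(obsLaw P), (∀ k, lH k ≤ o.X k ∧ o.X k ≤ uH k) →
      condX (obsLaw P) (fill yhi) o - γu = 0) ∧
    ENNReal.ofReal p ≤ obsLaw P {o | ∀ k, lH k + η ≤ o.X k ∧ o.X k ≤ uH k - η} ∧
    (∀ᵐ o ∂(obsLaw P), (∀ k, lL k ≤ o.X k ∧ o.X k ≤ uL k) →
      γl - condX (obsLaw P) (fill ylo) o = 0) ∧
    ENNReal.ofReal p ≤ obsLaw P {o | ∀ k, lL k + η ≤ o.X k ∧ o.X k ≤ uL k - η}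

end

end SelectionKS

/-! Write L = √(log n / n) and κ = c_n L. Everything random is confined to one event,
`GoodDeviations`: uniformly in θ, g and j, the squared error of a sample mean is at most C L² (σ̂² +
L²), and σ̂² is at most C times the second moment plus L². That the sample variance, and not a
uniform constant, governs the error is what makes studentization pay: an instrument with small mass
carries little noise.

This event has probability tending to one by symmetrization with a ghost sample. Given the pairs,
the difference of the two samples is a Rademacher sum, sub-Gaussian relative to its own root sum of
squares. The covering numbers at the empirical law of the 2n points supply a net of polynomial size,
and the union bound over it is beaten by exp(-q log n / 2) (`pi_exists_deviation_le`). Applied to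
the functions and to their centered squares, this trades population variances for sample ones
(`sampleVariance_bounds`). The constant C depends only on V and the bound on the moments, hence the
permitted dependence of K₀.

On the event the rest is deterministic. Since σ_n ≥ L, a studentized mean with nonnegative
expectation stays above -√(2C) L, and K K_{S,1} > √(2C) gives coverage
(`identifiedSet_subset_ksRegion`). Conversely, let θ lie at distance b outside the interval. If the
conditional gap is at most b/2 on some ball, an instrument g concentrated there, with mass G = E g,
has moment at most -(b/2) G and second moment of order at most G. Membership of θ in the region then
forces b G ≲ κ (√G + σ_n) (`mul_le_of_mem_ksRegion`). With G ≳ b^e and σ_n ≲ κ^(e/(e+2)) this yields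
b ≲ κ^(2/(e+2)) (`exists_rate_bound`). The three designs differ only in the exponent: e = d/α at a
finite point, e = 1/α at infinity, e = 0 for positive probability. -/

namespace SelectionKS

/-! ### Rademacher sums over finite nets -/

/-- A choice of sign for a Boolean. -/
def boolSign (b : Bool) : ℝ := if b then -1 else 1

/-- The exponential factors over coordinates, and cosh x ≤ exp(x²/2) bounds each factor. Counting
sign vectors instead of taking expectations explains the factor 2^n. -/
theorem sum_exp_boolSign_le {n : ℕ} (a : Fin n → ℝ) (t : ℝ) :
    ∑ e : Fin n → Bool, Real.exp (t * ∑ i, boolSign (e i) * a i)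
      ≤ 2 ^ n * Real.exp (t ^ 2 * (∑ i, a i ^ 2) / 2) := by
  have h1 : ∀ e : Fin n → Bool, Real.exp (t * ∑ i, boolSign (e i) * a i)
      = ∏ i, Real.exp (t * (boolSign (e i) * a i)) := by
    intro e
    rw [← Real.exp_sum, Finset.mul_sum]
  simp_rw [h1]
  rw [← Fintype.piFinset_univ, ← Finset.prod_univ_sum (fun _ => (Finset.univ : Finset Bool))
    (fun i b => Real.exp (t * (boolSign b * a i)))]
  have h2 : ∀ i, ∑ b : Bool, Real.exp (t * (boolSign b * a i))
      ≤ 2 * Real.exp ((t * a i) ^ 2 / 2) := by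
    intro i
    have := Real.cosh_le_exp_half_sq (t * a i)
    rw [Real.cosh_eq] at this
    simp only [Fintype.sum_bool, boolSign]
    simp
    linarith
  calc ∏ i, ∑ b : Bool, Real.exp (t * (boolSign b * a i))
      ≤ ∏ i, (2 * Real.exp ((t * a i) ^ 2 / 2)) :=
        Finset.prod_le_prod (fun i _ => Finset.sum_nonneg fun b _ => (Real.exp_pos _).le)
          (fun i _ => h2 i)
    _ = 2 ^ n * Real.exp (t ^ 2 * (∑ i, a i ^ 2) / 2) := by
        rw [Finset.prod_mul_distrib, ← Real.exp_sum]
        simp only [Finset.prod_const, Finset.card_univ, Fintype.card_fin]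
        congr 2
        rw [Finset.mul_sum, Finset.sum_div]
        exact Finset.sum_congr rfl fun i _ => by ring

theorem card_boolSign_sum_gt_le {n : ℕ} (a : Fin n → ℝ) {τ : ℝ} (hτ : 0 ≤ τ) :
    ((Finset.univ.filter fun e : Fin n → Bool =>
      τ * √(∑ i, a i ^ 2) < ∑ i, boolSign (e i) * a i).card : ℝ)
      ≤ 2 ^ n * Real.exp (-τ ^ 2 / 2) := by
  set s := √(∑ i, a i ^ 2) with hs
  have hs2 : s ^ 2 = ∑ i, a i ^ 2 := Real.sq_sqrt (Finset.sum_nonneg fun i _ => sq_nonneg _)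
  -- The Chernoff parameter τ/s needs s > 0. If s = 0, all weights vanish and the strict inequality
  -- holds for no sign vector.
  rcases (Real.sqrt_nonneg (∑ i, a i ^ 2)).eq_or_lt with h0 | h0
  · have ha : ∀ i, a i = 0 := by
      intro i
      have : ∑ i, a i ^ 2 = 0 := by rw [← hs2, hs, ← h0]; simp
      have := (Finset.sum_eq_zero_iff_of_nonneg (fun i _ => sq_nonneg (a i))).1 this i
        (Finset.mem_univ i)
      exact pow_eq_zero_iff two_ne_zero |>.1 this
    rw [← hs] at h0
    simp [ha, ← h0]
    positivity
  · rw [← hs] at h0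
    have h := sum_exp_boolSign_le a (τ / s)
    rw [← hs2, div_pow, div_mul_cancel₀ _ (by positivity)] at h
    have h2 : ((Finset.univ.filter fun e : Fin n → Bool =>
        τ * s < ∑ i, boolSign (e i) * a i).card : ℝ) * Real.exp (τ ^ 2)
        ≤ ∑ e : Fin n → Bool, Real.exp (τ / s * ∑ i, boolSign (e i) * a i) := by
      rw [← nsmul_eq_mul, ← Finset.sum_const]
      refine (Finset.sum_le_sum fun e he => ?_).trans
        (Finset.sum_le_sum_of_subset_of_nonneg (Finset.filter_subset _ _)
          fun e _ _ => (Real.exp_pos _).le)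
      rw [Real.exp_le_exp]
      have := (Finset.mem_filter.1 he).2
      calc τ ^ 2 = τ / s * (τ * s) := by field_simp
        _ ≤ _ := by gcongr
    have h3 : Real.exp (-τ ^ 2 / 2) * Real.exp (τ ^ 2) = Real.exp (τ ^ 2 / 2) := by
      rw [← Real.exp_add]; congr 1; ring
    refine le_of_mul_le_mul_right ?_ (Real.exp_pos (τ ^ 2))
    rw [mul_assoc, h3]
    exact h2.trans h

theorem card_boolSign_abs_sum_gt_le {n : ℕ} (a : Fin n → ℝ) {τ : ℝ} (hτ : 0 ≤ τ) :
    ((Finset.univ.filter fun e : Fin n → Bool =>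
      τ * √(∑ i, a i ^ 2) < |∑ i, boolSign (e i) * a i|).card : ℝ)
      ≤ 2 ^ n * (2 * Real.exp (-τ ^ 2 / 2)) := by
  have h1 := card_boolSign_sum_gt_le a hτ
  have h2 := card_boolSign_sum_gt_le (fun i => -a i) hτ
  simp only [neg_sq, mul_neg, Finset.sum_neg_distrib] at h2
  have h3 : (Finset.univ.filter fun e : Fin n → Bool =>
      τ * √(∑ i, a i ^ 2) < |∑ i, boolSign (e i) * a i|) =
      (Finset.univ.filter fun e : Fin n → Bool =>
      τ * √(∑ i, a i ^ 2) < ∑ i, boolSign (e i) * a i) ∪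
      (Finset.univ.filter fun e : Fin n → Bool =>
      τ * √(∑ i, a i ^ 2) < -∑ i, boolSign (e i) * a i) := by
    rw [← Finset.filter_or]
    simp only [lt_abs]
  rw [h3]
  have h4 := Finset.card_union_le (Finset.univ.filter fun e : Fin n → Bool =>
      τ * √(∑ i, a i ^ 2) < ∑ i, boolSign (e i) * a i)
      (Finset.univ.filter fun e : Fin n → Bool =>
      τ * √(∑ i, a i ^ 2) < -∑ i, boolSign (e i) * a i)
  have h5 : ((Finset.univ.filter (fun e : Fin n → Bool =>
      τ * √(∑ i, a i ^ 2) < ∑ i, boolSign (e i) * a i) ∪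
      Finset.univ.filter fun e : Fin n → Bool =>
      τ * √(∑ i, a i ^ 2) < -∑ i, boolSign (e i) * a i).card : ℝ) ≤ _ := Nat.cast_le.2 h4
  push_cast at h5
  linarith

/-- Triangle inequality in ℓ², followed by ℓ² ≤ ℓ¹. It lets an L₁ net control the self-normalizing
factor as well. -/
theorem sqrt_sum_sq_le_add {n : ℕ} (a b : Fin n → ℝ) :
    √(∑ i, b i ^ 2) ≤ √(∑ i, a i ^ 2) + ∑ i, |a i - b i| := by
  have h1 : √(∑ i, b i ^ 2) ≤ √(∑ i, a i ^ 2) + √(∑ i, (b i - a i) ^ 2) := by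
    have := norm_le_norm_add_norm_sub (WithLp.toLp 2 a) (WithLp.toLp 2 b)
    simpa [EuclideanSpace.norm_eq, sub_sq_comm] using this
  have h2 : √(∑ i, (b i - a i) ^ 2) ≤ ∑ i, |a i - b i| := by
    rw [Real.sqrt_le_left (Finset.sum_nonneg fun i _ => abs_nonneg _)]
    calc ∑ i, (b i - a i) ^ 2 = ∑ i, |a i - b i| ^ 2 :=
          Finset.sum_congr rfl fun i _ => by rw [sq_abs]; ring
      _ ≤ _ := Finset.sum_sq_le_sq_sum_of_nonneg fun i _ => abs_nonneg _
  linarith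

theorem abs_boolSign (b : Bool) : |boolSign b| = 1 := by
  cases b <;> simp [boolSign]

-- Union bound over the net, which depends on the pairs but not on the signs. Replacing f by its net
-- point moves the signed sum by at most δ and the root sum of squares by at most δ, which costs (1
-- + τ) δ in the threshold.
open Classical in
theorem card_exists_boolSign_sum_gt_le {Z : Type*} {n : ℕ} (F : Set (Z → ℝ)) (z z' : Fin n → Z)
    {N δ τ : ℝ} (hτ : 0 ≤ τ)
    (hcov : ∃ s : Finset (Z → ℝ), (s.card : ℝ) ≤ N ∧
      ∀ f ∈ F, ∃ h ∈ s, ∑ i, (|f (z i) - h (z i)| + |f (z' i) - h (z' i)|) ≤ δ) :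
    ((Finset.univ.filter fun e : Fin n → Bool => ∃ f ∈ F,
      τ * √(∑ i, (f (z i) - f (z' i)) ^ 2) + (1 + τ) * δ
        < |∑ i, boolSign (e i) * (f (z i) - f (z' i))|).card : ℝ)
      ≤ 2 ^ n * (2 * N * Real.exp (-τ ^ 2 / 2)) := by
  obtain ⟨s, hsN, hs⟩ := hcov
  have hsub : (Finset.univ.filter fun e : Fin n → Bool => ∃ f ∈ F,
      τ * √(∑ i, (f (z i) - f (z' i)) ^ 2) + (1 + τ) * δ
        < |∑ i, boolSign (e i) * (f (z i) - f (z' i))|) ⊆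
      s.biUnion fun h => Finset.univ.filter fun e : Fin n → Bool =>
        τ * √(∑ i, (h (z i) - h (z' i)) ^ 2) < |∑ i, boolSign (e i) * (h (z i) - h (z' i))| := by
    intro e he
    obtain ⟨f, hf, hfe⟩ := (Finset.mem_filter.1 he).2
    obtain ⟨h, hh, hd⟩ := hs f hf
    refine Finset.mem_biUnion.2 ⟨h, hh, Finset.mem_filter.2 ⟨Finset.mem_univ _, ?_⟩⟩
    have hd' : ∑ i, |(f (z i) - f (z' i)) - (h (z i) - h (z' i))| ≤ δ := by
      refine (Finset.sum_le_sum fun i _ => ?_).trans hd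
      calc |(f (z i) - f (z' i)) - (h (z i) - h (z' i))|
          = |(f (z i) - h (z i)) - (f (z' i) - h (z' i))| := by congr 1; ring
        _ ≤ _ := abs_sub _ _
    have h1 := sqrt_sum_sq_le_add (fun i => f (z i) - f (z' i)) (fun i => h (z i) - h (z' i))
    have h2 : |∑ i, boolSign (e i) * (f (z i) - f (z' i))|
        - |∑ i, boolSign (e i) * (h (z i) - h (z' i))| ≤ δ := by
      refine (abs_sub_abs_le_abs_sub _ _).trans (le_trans ?_ hd')
      rw [← Finset.sum_sub_distrib]
      refine (Finset.abs_sum_le_sum_abs _ _).trans (Finset.sum_le_sum fun i _ => ?_)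
      rw [← mul_sub, abs_mul, abs_boolSign, one_mul]
    have h3 := mul_le_mul_of_nonneg_left (h1.trans (add_le_add_right hd' _)) hτ
    linarith
  have h1 : ((Finset.univ.filter fun e : Fin n → Bool => ∃ f ∈ F,
      τ * √(∑ i, (f (z i) - f (z' i)) ^ 2) + (1 + τ) * δ
        < |∑ i, boolSign (e i) * (f (z i) - f (z' i))|).card : ℝ) ≤
      ∑ h ∈ s, ((Finset.univ.filter fun e : Fin n → Bool =>
        τ * √(∑ i, (h (z i) - h (z' i)) ^ 2)
          < |∑ i, boolSign (e i) * (h (z i) - h (z' i))|).card : ℝ) := by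
    exact_mod_cast (Finset.card_le_card hsub).trans Finset.card_biUnion_le
  refine h1.trans ((Finset.sum_le_sum fun h _ => card_boolSign_abs_sum_gt_le _ hτ).trans ?_)
  rw [Finset.sum_const, nsmul_eq_mul]
  have : 0 < 2 ^ n * (2 * Real.exp (-τ ^ 2 / 2)) := by positivity
  calc (s.card : ℝ) * (2 ^ n * (2 * Real.exp (-τ ^ 2 / 2)))
      ≤ N * (2 ^ n * (2 * Real.exp (-τ ^ 2 / 2))) := by gcongr
    _ = _ := by ring

/-! ### Symmetrization with a ghost sample -/

/-- Interchange the two halves of the pairs selected by `e`. -/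
def swapPairs {Z : Type*} {n : ℕ} (e : Fin n → Bool) (w : Fin n → Z × Z) : Fin n → Z × Z :=
  fun i => if e i then (w i).swap else w i

theorem measurePreserving_swapPairs {Z : Type*} [MeasurableSpace Z] (R : Measure Z)
    [IsProbabilityMeasure R] {n : ℕ} (e : Fin n → Bool) :
    MeasurePreserving (swapPairs e) (Measure.pi fun _ : Fin n => R.prod R)
      (Measure.pi fun _ : Fin n => R.prod R) := by
  refine measurePreserving_pi (f := fun i (p : Z × Z) => if e i then p.swap else p) _ _ fun i => ?_
  cases e i
  · exact MeasurePreserving.id (R.prod R)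
  · simpa using Measure.measurePreserving_swap (μ := R) (ν := R)

open Classical in
/-- Symmetrization: a set of paired samples that contains, for almost every pairing, at most the
share `r` of its coordinate swaps has probability at most `r`. -/
theorem pi_prod_le_of_swapPairs {Z : Type*} [MeasurableSpace Z] (R : Measure Z)
    [IsProbabilityMeasure R] {n : ℕ} {D : Set (Fin n → Z × Z)} (hD : MeasurableSet D) {r : ℝ}
    (h : ∀ᵐ w ∂(Measure.pi fun _ : Fin n => R.prod R),
      ((Finset.univ.filter fun e : Fin n → Bool => swapPairs e w ∈ D).card : ℝ) ≤ 2 ^ n * r) :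
    (Measure.pi fun _ : Fin n => R.prod R) D ≤ ENNReal.ofReal r := by
  set μ := Measure.pi fun _ : Fin n => R.prod R with hμ
  -- Swaps preserve the law, so 2^n μ(D) is the integral of the number of swaps that land in D.
  have h1 : ∀ e : Fin n → Bool, ∫⁻ w, D.indicator 1 (swapPairs e w) ∂μ = μ D := by
    intro e
    rw [(measurePreserving_swapPairs R e).lintegral_comp (measurable_one.indicator hD),
      lintegral_indicator_one hD]
  have h2 : (2 : ℝ≥0∞) ^ n * μ D = ∫⁻ w, ∑ e : Fin n → Bool, D.indicator 1 (swapPairs e w) ∂μ := by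
    rw [lintegral_finsetSum]
    · simp [h1]
    · intro e _
      exact (measurable_one.indicator hD).comp (measurePreserving_swapPairs R e).measurable
  have h3 : ∫⁻ w, ∑ e : Fin n → Bool, D.indicator 1 (swapPairs e w) ∂μ
      ≤ ∫⁻ _, ENNReal.ofReal (2 ^ n * r) ∂μ := by
    refine lintegral_mono_ae (h.mono fun w hw => ?_)
    have : ∑ e : Fin n → Bool, D.indicator (1 : (Fin n → Z × Z) → ℝ≥0∞) (swapPairs e w) =
        ((Finset.univ.filter fun e : Fin n → Bool => swapPairs e w ∈ D).card : ℝ≥0∞) := by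
      simp [Set.indicator_apply, Finset.sum_boole]
    rw [this, ← ENNReal.ofReal_natCast]
    exact ENNReal.ofReal_le_ofReal hw
  rw [lintegral_const, measure_univ, mul_one, ENNReal.ofReal_mul (by positivity),
    ENNReal.ofReal_pow (by positivity), ENNReal.ofReal_ofNat, ← h2] at h3
  exact (ENNReal.mul_le_mul_iff_right (by positivity) (by finiteness)).1 h3

/-- Symmetrized deviations, normalized by their own root sum of squares, over a countable class
with a finite net on almost every paired sample. -/
theorem prod_exists_symm_deviation_le {Z : Type*} [MeasurableSpace Z] (R : Measure Z)
    [IsProbabilityMeasure R] {n : ℕ} {F : Set (Z → ℝ)} (hF : F.Countable)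
    (hmeas : ∀ f ∈ F, Measurable f) {good : Set Z} (hgood : ∀ᵐ z ∂(R), z ∈ good)
    {N δ τ : ℝ} (hτ : 0 ≤ τ)
    (hcov : ∀ z z' : Fin n → Z, (∀ i, z i ∈ good) → (∀ i, z' i ∈ good) →
      ∃ s : Finset (Z → ℝ), (s.card : ℝ) ≤ N ∧
        ∀ f ∈ F, ∃ h ∈ s, ∑ i, (|f (z i) - h (z i)| + |f (z' i) - h (z' i)|) ≤ δ) :
    MeasurableSet {p : (Fin n → Z) × (Fin n → Z) | ∃ f ∈ F,
      τ * √(∑ i, (f (p.1 i) - f (p.2 i)) ^ 2) + (1 + τ) * δ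
        < |∑ i, (f (p.1 i) - f (p.2 i))|} ∧
    ((Measure.pi fun _ : Fin n => R).prod (Measure.pi fun _ : Fin n => R))
      {p | ∃ f ∈ F, τ * √(∑ i, (f (p.1 i) - f (p.2 i)) ^ 2) + (1 + τ) * δ
        < |∑ i, (f (p.1 i) - f (p.2 i))|} ≤ ENNReal.ofReal (2 * N * Real.exp (-τ ^ 2 / 2)) := by
  classical
  set D := {p : (Fin n → Z) × (Fin n → Z) | ∃ f ∈ F,
      τ * √(∑ i, (f (p.1 i) - f (p.2 i)) ^ 2) + (1 + τ) * δ
        < |∑ i, (f (p.1 i) - f (p.2 i))|} with hDdef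
  have hD : MeasurableSet D := by
    have : D = ⋃ f ∈ F, {p : (Fin n → Z) × (Fin n → Z) |
        τ * √(∑ i, (f (p.1 i) - f (p.2 i)) ^ 2) + (1 + τ) * δ
        < |∑ i, (f (p.1 i) - f (p.2 i))|} := by
      ext p; simp [hDdef]
    rw [this]
    refine MeasurableSet.biUnion hF fun f hf => ?_
    have := hmeas f hf
    refine measurableSet_lt ?_ ?_ <;> fun_prop
  refine ⟨hD, ?_⟩
  have hmp := measurePreserving_arrowProdEquivProdArrow Z Z (Fin n) (fun _ => R) (fun _ => R)
  rw [← hmp.measure_preimage hD.nullMeasurableSet]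
  refine pi_prod_le_of_swapPairs R (hmp.measurable hD) ?_
  have hae : ∀ᵐ w ∂(Measure.pi fun _ : Fin n => R.prod R),
      ∀ i, (w i).1 ∈ good ∧ (w i).2 ∈ good := by
    rw [ae_all_iff]
    intro i
    have h1 : ∀ᵐ p ∂(R.prod R), p.1 ∈ good ∧ p.2 ∈ good :=
      (Measure.quasiMeasurePreserving_fst.ae hgood).and
        (Measure.quasiMeasurePreserving_snd.ae hgood)
    exact (measurePreserving_eval (fun _ : Fin n => R.prod R) i).quasiMeasurePreserving.ae h1
  refine hae.mono fun w hw => ?_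
  have key := card_exists_boolSign_sum_gt_le F (fun i => (w i).1) (fun i => (w i).2) hτ
    (hcov _ _ (fun i => (hw i).1) (fun i => (hw i).2))
  refine le_trans (le_of_eq ?_) key
  congr 3
  ext e
  refine exists_congr fun f => and_congr_right fun _ => ?_
  -- Swapping a pair flips the sign of its difference and leaves the square unchanged, so the
  -- normalization is the same for all swaps.
  have h1 : ∀ i, (f ((swapPairs e w i).1) - f ((swapPairs e w i).2))
      = boolSign (e i) * (f (w i).1 - f (w i).2) := by
    intro i
    simp only [swapPairs, boolSign]
    split_ifs <;> simp
  have h2 : ∀ i, (f ((swapPairs e w i).1) - f ((swapPairs e w i).2)) ^ 2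
      = (f (w i).1 - f (w i).2) ^ 2 := by
    intro i
    rw [h1, mul_pow, ← sq_abs (boolSign _), abs_boolSign, one_pow, one_mul]
  change (_ * √(∑ i, (f (swapPairs e w i).1 - f (swapPairs e w i).2) ^ 2) + _
    < |∑ i, (f (swapPairs e w i).1 - f (swapPairs e w i).2)|) ↔ _
  simp_rw [h2, h1]

/-- Markov's inequality: each of the two terms has expectation n Var f, so their sum has expectation
at most 2W. This says that the ghost sample is typical with probability at least one half. -/
theorem half_le_pi_centered {Z : Type*} [MeasurableSpace Z] (R : Measure Z)
    [IsProbabilityMeasure R] {n : ℕ} {f : Z → ℝ} (hf : Measurable f) (hf2 : MemLp f 2 R)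
    {W : ℝ} (hW : n * Var[f; R] ≤ W) (hW0 : 0 < W) :
    1 / 2 ≤ (Measure.pi fun _ : Fin n => R) {z | (∑ i, f (z i) - n * ∫ x, f x ∂(R)) ^ 2
      + ∑ i, (f (z i) - ∫ x, f x ∂(R)) ^ 2 < 4 * W} := by
  set μ := Measure.pi fun _ : Fin n => R with hμ
  set m := ∫ x, f x ∂(R) with hm
  have hfi : Integrable f R := hf2.integrable one_le_two
  have hev : ∀ i : Fin n, MeasurePreserving (fun z : Fin n → Z => z i) μ R :=
    fun i => measurePreserving_eval (fun _ => R) i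
  have hLi : ∀ i : Fin n, MemLp (fun z : Fin n → Z => f (z i)) 2 μ :=
    fun i => hf2.comp_measurePreserving (hev i)
  have hsum : MemLp (fun z : Fin n → Z => ∑ i, f (z i)) 2 μ :=
    memLp_finsetSum _ fun i _ => hLi i
  have hmean : ∫ z, ∑ i, f (z i) ∂μ = n * m := by
    rw [integral_finsetSum _ fun i _ => (hLi i).integrable one_le_two]
    have : ∀ i : Fin n, ∫ z, f (z i) ∂μ = m := fun i => by
      rw [hm, ← (hev i).map_eq, integral_map (hev i).measurable.aemeasurable
        hf.aestronglyMeasurable]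
    simp [this]
  have hi1 : Integrable (fun z : Fin n → Z => (∑ i, f (z i) - n * m) ^ 2) μ :=
    (hsum.sub (memLp_const _)).integrable_sq
  have hv1 : ∫ z, (∑ i, f (z i) - n * m) ^ 2 ∂μ = n * Var[f; R] := by
    rw [← hmean, ← variance_eq_integral hsum.aestronglyMeasurable.aemeasurable]
    have := variance_sum_pi (μ := fun _ : Fin n => R) (X := fun _ => f) fun _ => hf2
    simp only [Finset.sum_const, Finset.card_univ, Fintype.card_fin, nsmul_eq_mul] at this
    rw [← this]
    congr 1
    ext z
    simp
  have hi2' : ∀ i : Fin n, Integrable (fun z : Fin n → Z => (f (z i) - m) ^ 2) μ :=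
    fun i => ((hLi i).sub (memLp_const _)).integrable_sq
  have hi2 : Integrable (fun z : Fin n → Z => ∑ i, (f (z i) - m) ^ 2) μ :=
    integrable_finsetSum _ fun i _ => hi2' i
  have hv2 : ∫ z, ∑ i, (f (z i) - m) ^ 2 ∂μ = n * Var[f; R] := by
    rw [integral_finsetSum _ fun i _ => hi2' i]
    have : ∀ i : Fin n, ∫ z, (f (z i) - m) ^ 2 ∂μ = Var[f; R] := fun i => by
      rw [variance_eq_integral hf.aemeasurable, ← hm, ← (hev i).map_eq,
        integral_map (hev i).measurable.aemeasurable
        (by fun_prop)]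
    simp [this]
  have hmk := mul_meas_ge_le_integral_of_nonneg (μ := μ)
    (f := fun z => (∑ i, f (z i) - n * m) ^ 2 + ∑ i, (f (z i) - m) ^ 2)
    (Eventually.of_forall fun z => by
      simp only [Pi.zero_apply]
      exact add_nonneg (sq_nonneg _) (Finset.sum_nonneg fun i _ => sq_nonneg _))
    (hi1.add hi2) (4 * W)
  rw [integral_add hi1 hi2, hv1, hv2] at hmk
  have hr : μ.real {z | 4 * W ≤ (∑ i, f (z i) - n * m) ^ 2 + ∑ i, (f (z i) - m) ^ 2} ≤ 1 / 2 := by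
    by_contra hcon
    push Not at hcon
    nlinarith
  have hms : MeasurableSet {z : Fin n → Z |
      4 * W ≤ (∑ i, f (z i) - n * m) ^ 2 + ∑ i, (f (z i) - m) ^ 2} :=
    measurableSet_le (by fun_prop) (by fun_prop)
  have hcompl := measureReal_compl (μ := μ) hms
  rw [probReal_univ] at hcompl
  have hset : {z : Fin n → Z | 4 * W ≤ (∑ i, f (z i) - n * m) ^ 2 + ∑ i, (f (z i) - m) ^ 2}ᶜ
      = {z | (∑ i, f (z i) - n * m) ^ 2 + ∑ i, (f (z i) - m) ^ 2 < 4 * W} := by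
    ext z; simp
  rw [hset] at hcompl
  have h2 : 1 / 2 ≤ μ.real {z | (∑ i, f (z i) - n * m) ^ 2 + ∑ i, (f (z i) - m) ^ 2 < 4 * W} := by
    linarith
  rw [Measure.real, ← ENNReal.ofReal_le_iff_le_toReal (by finiteness)] at h2
  refine le_trans (le_of_eq ?_) h2
  rw [ENNReal.ofReal_div_of_pos two_pos]
  simp

/-- Fubini and Markov. The set B need not be measurable, since it is enlarged to the measurable set
of points with section of measure at least 1/2. -/
theorem le_two_mul_prod_of_half_le {α β : Type*} [MeasurableSpace α] [MeasurableSpace β]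
    (μ : Measure α) (ν : Measure β) [SFinite ν] {D : Set (α × β)}
    (hD : MeasurableSet D) {B : Set α} (h : ∀ x ∈ B, 1 / 2 ≤ ν {y | (x, y) ∈ D}) :
    μ B ≤ 2 * (μ.prod ν) D := by
  rw [Measure.prod_apply hD]
  have h1 := mul_meas_ge_le_lintegral (μ := μ) (measurable_measure_prodMk_left hD (ν := ν)) (1 / 2)
  have h2 : μ B ≤ μ {x | 1 / 2 ≤ ν (Prod.mk x ⁻¹' D)} := measure_mono fun x hx => h x hx
  calc μ B = 2 * (1 / 2 * μ B) := by
        rw [← mul_assoc, one_div, ENNReal.mul_inv_cancel two_ne_zero (by finiteness), one_mul]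
    _ ≤ 2 * (1 / 2 * μ {x | 1 / 2 ≤ ν (Prod.mk x ⁻¹' D)}) := by gcongr
    _ ≤ _ := by gcongr

/-- A large deviation of u survives subtraction of a typical v. With w = √W ≥ 1 and t = √l ≥ 1, the
constant 4 + 5√q is what is needed: 4tw absorbs the ghost deviation 2w and the net error 2, and 5√q
tw absorbs 3√q tw from the normalization and 2√q t from the net. -/
theorem symm_deviation_of_deviation {n : ℕ} (hn : 1 ≤ n) {q l W m : ℝ} (hl : 1 ≤ l)
    (hW : l ≤ W) (u v : Fin n → ℝ)
    (hu : (4 + 5 * √q) * √l * (√(∑ i, (u i - m) ^ 2) + √W) < |∑ i, u i - n * m|)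
    (hv : (∑ i, v i - n * m) ^ 2 + ∑ i, (v i - m) ^ 2 < 4 * W) :
    √q * √l * √(∑ i, (u i - v i) ^ 2) + (1 + √q * √l) * (2 / n) < |∑ i, (u i - v i)| := by
  have hW0 : 0 ≤ W := by linarith
  set a := √(∑ i, (u i - m) ^ 2)
  have ha : a ^ 2 = ∑ i, (u i - m) ^ 2 := Real.sq_sqrt (Finset.sum_nonneg fun i _ => sq_nonneg _)
  set w := √W
  have hw : w ^ 2 = W := Real.sq_sqrt hW0
  set r := √q
  set t := √l
  have hr : 0 ≤ r := Real.sqrt_nonneg _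
  have ht : 1 ≤ t := Real.one_le_sqrt.2 hl
  have htw : t ≤ w := Real.sqrt_le_sqrt hW
  have ha0 : 0 ≤ a := Real.sqrt_nonneg _
  have hV : 0 ≤ ∑ i, (v i - m) ^ 2 := Finset.sum_nonneg fun i _ => sq_nonneg _
  have h1 : |∑ i, v i - n * m| ≤ 2 * w := by
    refine abs_le_of_sq_le_sq ?_ (by positivity)
    nlinarith
  have h2 : √(∑ i, (u i - v i) ^ 2) ≤ 2 * a + 3 * w := by
    rw [Real.sqrt_le_left (by positivity)]
    calc ∑ i, (u i - v i) ^ 2 ≤ ∑ i, (2 * (u i - m) ^ 2 + 2 * (v i - m) ^ 2) :=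
          Finset.sum_le_sum fun i _ => by nlinarith [sq_nonneg ((u i - m) + (v i - m))]
      _ = 2 * a ^ 2 + 2 * ∑ i, (v i - m) ^ 2 := by
          rw [Finset.sum_add_distrib, ← Finset.mul_sum, ← Finset.mul_sum, ha]
      _ ≤ (2 * a + 3 * w) ^ 2 := by
          nlinarith [sq_nonneg (∑ i, v i - n * m), mul_nonneg ha0 (by positivity : 0 ≤ w)]
  have h3 : |∑ i, u i - n * m| - |∑ i, v i - n * m| ≤ |∑ i, (u i - v i)| := by
    refine (abs_sub_abs_le_abs_sub _ _).trans (le_of_eq ?_)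
    rw [Finset.sum_sub_distrib]
    congr 1
    ring
  have h4 : (2 : ℝ) / n ≤ 2 := by
    rw [div_le_iff₀ (by positivity)]
    have : (1 : ℝ) ≤ n := by exact_mod_cast hn
    linarith
  have h5 : r * t * √(∑ i, (u i - v i) ^ 2) ≤ r * t * (2 * a + 3 * w) := by gcongr
  have h6 : (1 + r * t) * (2 / n) ≤ (1 + r * t) * 2 := by gcongr
  have h7 : 0 ≤ t * a := by positivity
  have h8 : 1 ≤ w := ht.trans htw
  have h9 : w ≤ t * w := by nlinarith
  have h10 : r * t ≤ r * (t * w) := by gcongr; nlinarith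
  have h11 : 0 ≤ r * (t * a) := by positivity
  nlinarith

/-- Uniform self-normalized deviations over a countable class with finite nets on samples. -/
theorem pi_exists_deviation_le {Z : Type*} [MeasurableSpace Z] (R : Measure Z)
    [IsProbabilityMeasure R] {n : ℕ} (hn : 1 ≤ n) {F : Set (Z → ℝ)} (hF : F.Countable)
    (hmeas : ∀ f ∈ F, Measurable f) (hF2 : ∀ f ∈ F, MemLp f 2 R)
    {good : Set Z} (hgood : ∀ᵐ z ∂(R), z ∈ good) {N q l : ℝ} (hq : 0 ≤ q) (hl : 1 ≤ l)
    (hcov : ∀ z z' : Fin n → Z, (∀ i, z i ∈ good) → (∀ i, z' i ∈ good) →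
      ∃ s : Finset (Z → ℝ), (s.card : ℝ) ≤ N ∧
        ∀ f ∈ F, ∃ h ∈ s, ∑ i, (|f (z i) - h (z i)| + |f (z' i) - h (z' i)|) ≤ 2 / n) :
    (Measure.pi fun _ : Fin n => R) {z | ∃ f ∈ F, (4 + 5 * √q) * √l *
        (√(∑ i, (f (z i) - ∫ x, f x ∂(R)) ^ 2) + √(n * Var[f; R] + l))
        < |∑ i, f (z i) - n * ∫ x, f x ∂(R)|}
      ≤ 2 * ENNReal.ofReal (2 * N * Real.exp (-(q * l) / 2)) := by
  -- The threshold τ = √q √l turns the sub-Gaussian tail into exp(-q l / 2).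
  obtain ⟨hD, hle⟩ := prod_exists_symm_deviation_le R hF hmeas hgood
    (τ := √q * √l) (by positivity) hcov
  rw [mul_pow, Real.sq_sqrt hq, Real.sq_sqrt (by linarith)] at hle
  refine (le_two_mul_prod_of_half_le _ (Measure.pi fun _ : Fin n => R) hD ?_).trans (by gcongr)
  rintro z ⟨f, hf, hz⟩
  have hv := variance_nonneg f R
  have hnv : 0 ≤ n * Var[f; R] := by positivity
  refine (half_le_pi_centered R (hmeas f hf) (hF2 f hf) (W := n * Var[f; R] + l)
    (by linarith) (by linarith)).trans (measure_mono fun z' hz' => ?_)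
  exact ⟨f, hf, symm_deviation_of_deviation hn hl (by linarith) (fun i => f (z i))
    (fun i => f (z' i)) hz hz'⟩

/-! ### Observations, and nets from covering numbers -/

theorem measurable_observe {d : ℕ} : Measurable (observe (d := d)) := by
  unfold observe
  refine Measurable.prodMk ?_ (by fun_prop)
  refine Measurable.ite ?_ (by fun_prop) (by fun_prop)
  exact (measurable_fst.comp measurable_snd) (MeasurableSet.singleton true)

theorem measurable_X {d : ℕ} : Measurable (Obs.X (d := d)) :=
  measurable_snd.comp measurable_snd

theorem measurable_fill {d : ℕ} (w : ℝ) : Measurable (fill (d := d) w) := by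
  unfold fill
  refine Measurable.ite ?_ (by fun_prop) (by fun_prop)
  exact (measurable_fst.comp measurable_snd) (MeasurableSet.singleton true)

theorem measurable_moment {d : ℕ} (ylo yhi : ℝ) (j : Fin 2) (θ : ℝ) :
    Measurable (moment (d := d) ylo yhi j θ) := by
  unfold moment
  split_ifs
  · exact measurable_const.sub (measurable_fill _)
  · exact (measurable_fill _).sub measurable_const

theorem measurable_weighted {d : ℕ} (ylo yhi θ : ℝ) {g : Euc d → Fin 2 → ℝ} (hg : Measurable g)
    (j : Fin 2) : Measurable (weighted ylo yhi θ g j) :=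
  (measurable_moment ylo yhi j θ).mul
    ((measurable_pi_apply j).comp (hg.comp measurable_X))

theorem IsSelectionModel.isProbabilityMeasure_obsLaw {d : ℕ} {ylo yhi : ℝ}
    {P : Measure (Latent d)} (h : IsSelectionModel ylo yhi P) :
    IsProbabilityMeasure (obsLaw P) := by
  have := h.prob
  exact Measure.isProbabilityMeasure_map measurable_observe.aemeasurable

/-- Observations whose outcomes are in the known range. -/
def inRange {d : ℕ} (ylo yhi : ℝ) : Set (Obs d) :=
  {o | fill ylo o ∈ Set.Icc ylo yhi ∧ fill yhi o ∈ Set.Icc ylo yhi}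

theorem IsSelectionModel.ae_inRange {d : ℕ} {ylo yhi : ℝ}
    {P : Measure (Latent d)} (h : IsSelectionModel ylo yhi P) :
    ∀ᵐ o ∂(obsLaw P), o ∈ inRange ylo yhi := by
  have hms : MeasurableSet {o : Obs d | o ∈ inRange ylo yhi} :=
    ((measurable_fill ylo) measurableSet_Icc).inter ((measurable_fill yhi) measurableSet_Icc)
  rw [obsLaw, ae_map_iff measurable_observe.aemeasurable hms]
  refine h.bounded.mono fun u hu => ?_
  have : ylo ≤ yhi := hu.1.trans hu.2
  simp only [inRange, fill, observe, Set.mem_ofPred_eq, Set.mem_Icc]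
  split_ifs <;> simp [hu, this]

/-- The `L₁` covering numbers at the empirical law of a paired sample give finite nets on it. -/
theorem exists_net_of_covering {d : ℕ} {ylo yhi : ℝ} {F : Set (Obs d → ℝ)} {A V : ℝ}
    (hF : ∀ Q : Measure (Obs d), IsProbabilityMeasure Q →
      (∀ᵐ o ∂Q, fill ylo o ∈ Set.Icc ylo yhi ∧ fill yhi o ∈ Set.Icc ylo yhi) →
      ∀ ε : ℝ, 0 < ε → ε < 1 →
        ((coveringNumber ε F Q : ℕ∞) : ℝ≥0∞) ≤ ENNReal.ofReal (A * ε ^ (-V)))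
    (hA : 0 < A) {n : ℕ} (hn : 2 ≤ n) (z z' : Fin n → Obs d) (hz : ∀ i, z i ∈ inRange ylo yhi)
    (hz' : ∀ i, z' i ∈ inRange ylo yhi) :
    ∃ s : Finset (Obs d → ℝ), (s.card : ℝ) ≤ A * (1 / (n : ℝ) ^ 2) ^ (-V) ∧
      ∀ f ∈ F, ∃ h ∈ s, ∑ i, (|f (z i) - h (z i)| + |f (z' i) - h (z' i)|) ≤ 2 / n := by
  have hn0 : (0 : ℝ) < n := by positivity
  have hn2 : (2 : ℝ) ≤ n := by exact_mod_cast hn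
  -- The empirical law of all 2n points. At radius 1/n², which is below 1 because n ≥ 2, an L₁(Q)
  -- bound becomes a bound 2n · 1/n² = 2/n on the sum.
  set Q : Measure (Obs d) := ENNReal.ofReal (1 / (2 * n)) •
    ∑ i, (Measure.dirac (z i) + Measure.dirac (z' i)) with hQ
  have hlint : ∀ φ : Obs d → ℝ≥0∞, ∫⁻ o, φ o ∂Q
      = ENNReal.ofReal (1 / (2 * n)) * ∑ i, (φ (z i) + φ (z' i)) := by
    intro φ
    rw [hQ, lintegral_smul_measure, lintegral_finsetSum_measure]
    simp [lintegral_add_measure, lintegral_dirac]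
  have hprob : IsProbabilityMeasure Q := by
    constructor
    have h1 := hlint 1
    simp only [Pi.one_apply, lintegral_one, Finset.sum_const, Finset.card_univ,
      Fintype.card_fin, nsmul_eq_mul] at h1
    rw [h1, show ((n : ℝ≥0∞) * (1 + 1)) = ENNReal.ofReal (2 * n) by
      rw [ENNReal.ofReal_mul (by positivity)]; simp; norm_num; ring,
      ← ENNReal.ofReal_mul (by positivity)]
    rw [one_div, inv_mul_cancel₀ (by positivity), ENNReal.ofReal_one]
  have hae : ∀ᵐ o ∂Q, fill ylo o ∈ Set.Icc ylo yhi ∧ fill yhi o ∈ Set.Icc ylo yhi := by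
    refine Measure.ae_smul_measure ?_ _
    rw [← Measure.sum_fintype, Measure.ae_sum_iff]
    intro i
    rw [ae_add_measure_iff, ae_dirac_eq, ae_dirac_eq]
    exact ⟨hz i, hz' i⟩
  have hε1 : 1 / (n : ℝ) ^ 2 < 1 := by
    rw [div_lt_one (by positivity)]; nlinarith
  have hc := hF Q hprob hae (1 / (n : ℝ) ^ 2) (by positivity) hε1
  set N := coveringNumber (1 / (n : ℝ) ^ 2) F Q with hN
  have hNtop : N ≠ ⊤ := by
    intro h
    rw [h] at hc
    simp at hc
  -- A finite infimum in ℕ∞ is attained.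
  obtain ⟨s, hs⟩ : ∃ s : Finset (Obs d → ℝ), (((∀ h ∈ s, Integrable h Q) ∧
      ∀ f ∈ F, ∃ h ∈ s, ∫⁻ z, ‖f z - h z‖ₑ ∂Q ≤ ENNReal.ofReal (1 / (n : ℝ) ^ 2)) ∧
      (s.card : ℕ∞) ≤ N) := by
    by_contra hcon
    push Not at hcon
    have : N + 1 ≤ N := by
      conv_rhs => rw [hN, coveringNumber]
      refine le_iInf₂ fun s hs => ?_
      exact Order.add_one_le_of_lt (hcon s hs)
    exact absurd this (not_le.2 ((ENat.lt_add_one_iff hNtop).2 le_rfl))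
  refine ⟨s, ?_, fun f hf => ?_⟩
  · have h1 : ((s.card : ℕ∞) : ℝ≥0∞) ≤ ENNReal.ofReal (A * (1 / (n : ℝ) ^ 2) ^ (-V)) :=
      (by exact_mod_cast hs.2 : ((s.card : ℕ∞) : ℝ≥0∞) ≤ (N : ℝ≥0∞)).trans hc
    rw [ENat.toENNReal_coe, ← ENNReal.ofReal_natCast,
      ENNReal.ofReal_le_ofReal_iff (by positivity)] at h1
    exact h1
  · obtain ⟨h, hh, hle⟩ := hs.1.2 f hf
    refine ⟨h, hh, ?_⟩
    rw [hlint] at hle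
    have h1 : ∑ i, (‖f (z i) - h (z i)‖ₑ + ‖f (z' i) - h (z' i)‖ₑ)
        = ENNReal.ofReal (∑ i, (|f (z i) - h (z i)| + |f (z' i) - h (z' i)|)) := by
      rw [ENNReal.ofReal_sum_of_nonneg fun i _ => by positivity]
      refine Finset.sum_congr rfl fun i _ => ?_
      rw [ENNReal.ofReal_add (abs_nonneg _) (abs_nonneg _), Real.enorm_eq_ofReal_abs,
        Real.enorm_eq_ofReal_abs]
    rw [h1, ← ENNReal.ofReal_mul (by positivity),
      ENNReal.ofReal_le_ofReal_iff (by positivity)] at hle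
    have h2 := mul_le_mul_of_nonneg_left hle (by positivity : (0 : ℝ) ≤ 2 * n)
    rw [← mul_assoc, mul_one_div_cancel (by positivity), one_mul] at h2
    refine h2.trans (le_of_eq ?_)
    field_simp

/-! ### Errors governed by the sample variance -/

/-- Deviation bounds for a function and its squared deviation give bounds in terms of the sample
variance. -/
theorem sampleVariance_bounds {n : ℕ} (hn : 1 ≤ n) {C l m v vh Y : ℝ} (hC : 0 ≤ C)
    (hl : 0 ≤ l) (u : Fin n → ℝ) (hu : ∀ i, (u i - m) ^ 2 ≤ 4 * Y ^ 2) (hv0 : 0 ≤ v)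
    (hvY : v ≤ 4 * Y ^ 2) (hvh : vh ≤ 4 * Y ^ 2 * v)
    (h1 : |∑ i, u i - n * m| ≤ C * √l * (√(∑ i, (u i - m) ^ 2) + √(n * v + l)))
    (h2 : |∑ i, (u i - m) ^ 2 - n * v|
      ≤ C * √l * (√(∑ i, ((u i - m) ^ 2 - v) ^ 2) + √(n * vh + l)))
    (hln : C ^ 2 * (8 + 4 * (36 * Y ^ 2 * C ^ 2 + 2 * C)) * l ≤ n / 2) :
    ((∑ i, u i) / n - m) ^ 2 ≤ 2 * (C ^ 2 * (8 + 4 * (36 * Y ^ 2 * C ^ 2 + 2 * C))) * (l / n) *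
      ((∑ i, u i ^ 2) / n - ((∑ i, u i) / n) ^ 2 + l / n) ∧
    (∑ i, u i ^ 2) / n - ((∑ i, u i) / n) ^ 2 ≤
      2 * v + 2 * (36 * Y ^ 2 * C ^ 2 + 2 * C) * (l / n) := by
  have hn0 : (0 : ℝ) < n := by positivity
  set D := 36 * Y ^ 2 * C ^ 2 + 2 * C with hD
  have hD0 : 0 ≤ D := by positivity
  set E := C ^ 2 * (8 + 4 * D) with hE
  have hE0 : 0 ≤ E := by positivity
  set X := ∑ i, (u i - m) ^ 2 with hX
  have hX0 : 0 ≤ X := Finset.sum_nonneg fun i _ => sq_nonneg _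
  have hVp : 0 ≤ n * v := by positivity
  have hsq : ∀ p r : ℝ, 0 ≤ p → 0 ≤ r → (C * √l * (√p + √r)) ^ 2 ≤ C ^ 2 * l * (2 * (p + r)) := by
    intro p r hp hr
    rw [mul_pow, mul_pow, Real.sq_sqrt hl]
    have : (√p + √r) ^ 2 ≤ 2 * (p + r) := by
      nlinarith [sq_nonneg (√p - √r), Real.sq_sqrt hp, Real.sq_sqrt hr]
    gcongr
  have hsumh : ∑ i, ((u i - m) ^ 2 - v) ^ 2 ≤ 8 * Y ^ 2 * (X + n * v) := by
    calc ∑ i, ((u i - m) ^ 2 - v) ^ 2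
        ≤ ∑ i, (8 * Y ^ 2 * (u i - m) ^ 2 + 8 * Y ^ 2 * v) := by
          refine Finset.sum_le_sum fun i _ => ?_
          nlinarith [sq_nonneg ((u i - m) ^ 2 + v), hu i, sq_nonneg (u i - m)]
      _ = _ := by
          rw [Finset.sum_add_distrib, ← Finset.mul_sum]
          simp
          ring
  have key2 : (X - n * v) ^ 2 ≤ C ^ 2 * l * (24 * Y ^ 2 * (X + n * v) + 2 * l) := by
    have hr : √(n * vh + l) ≤ √(4 * Y ^ 2 * (X + n * v) + l) := by
      apply Real.sqrt_le_sqrt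
      have : n * vh ≤ n * (4 * Y ^ 2 * v) := by gcongr
      have : 0 ≤ 4 * Y ^ 2 * X := by positivity
      linarith
    have h3 : |X - n * v| ≤ C * √l * (√(8 * Y ^ 2 * (X + n * v)) +
        √(4 * Y ^ 2 * (X + n * v) + l)) :=
      h2.trans (by gcongr)
    rw [← sq_abs]
    refine (pow_le_pow_left₀ (abs_nonneg _) h3 2).trans
      ((hsq _ _ (by positivity) (by positivity)).trans (le_of_eq (by ring)))
  -- Completing the square: D ≥ 36Y²C² covers the cross term and D ≥ 2C the term in l². Consequently
  -- X and n v agree up to a factor 2 and a multiple of D l.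
  have key3 : |X - n * v| ≤ (X + n * v) / 3 + D * l := by
    refine abs_le_of_sq_le_sq (key2.trans ?_) (by positivity)
    have e1 : C ^ 2 * l * (24 * Y ^ 2 * (X + n * v)) ≤ 2 / 3 * D * l * (X + n * v) := by
      have : C ^ 2 * (24 * Y ^ 2) ≤ 2 / 3 * D := by rw [hD]; nlinarith
      calc _ = C ^ 2 * (24 * Y ^ 2) * (l * (X + n * v)) := by ring
        _ ≤ 2 / 3 * D * (l * (X + n * v)) := by gcongr
        _ = _ := by ring
    have e2 : 2 * C ^ 2 ≤ D ^ 2 := by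
      have : 2 * C ≤ D := by rw [hD]; have : 0 ≤ 36 * Y ^ 2 * C ^ 2 := by positivity
                             linarith
      nlinarith
    have e3 : 2 * C ^ 2 * l ^ 2 ≤ D ^ 2 * l ^ 2 := by gcongr
    calc C ^ 2 * l * (24 * Y ^ 2 * (X + n * v) + 2 * l)
        = C ^ 2 * l * (24 * Y ^ 2 * (X + n * v)) + 2 * C ^ 2 * l ^ 2 := by ring
      _ ≤ ((X + n * v) / 3) ^ 2 + (2 / 3 * D * l * (X + n * v) + D ^ 2 * l ^ 2) := by
          linarith [sq_nonneg ((X + n * v) / 3)]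
      _ = _ := by ring
  have k := abs_le.1 key3
  have key1 : (∑ i, u i - n * m) ^ 2 ≤ E * l * (X + l) := by
    rw [← sq_abs]
    refine (pow_le_pow_left₀ (abs_nonneg _) h1 2).trans
      ((hsq _ _ (by positivity) (by positivity)).trans ?_)
    have : 2 * (X + (n * v + l)) ≤ (8 + 4 * D) * (X + l) := by
      have e1 : 0 ≤ D * X := by positivity
      have e2 : 0 ≤ D * l := by positivity
      linarith [k.1]
    calc C ^ 2 * l * (2 * (X + (n * v + l))) ≤ C ^ 2 * l * ((8 + 4 * D) * (X + l)) := by gcongr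
      _ = _ := by rw [hE]; ring
  have hXeq : X = n * ((∑ i, u i ^ 2) / n - ((∑ i, u i) / n) ^ 2) + (∑ i, u i - n * m) ^ 2 / n := by
    have : X = ∑ i, u i ^ 2 - 2 * m * ∑ i, u i + n * m ^ 2 := by
      rw [hX, Finset.mul_sum, ← Finset.sum_sub_distrib]
      have : ∑ _i : Fin n, m ^ 2 = n * m ^ 2 := by simp
      rw [← this, ← Finset.sum_add_distrib]
      exact Finset.sum_congr rfl fun i _ => by ring
    rw [this]
    field_simp
    ring
  set s2 := (∑ i, u i ^ 2) / n - ((∑ i, u i) / n) ^ 2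
  constructor
  · have h3 : E * l * ((∑ i, u i - n * m) ^ 2 / n) ≤ (∑ i, u i - n * m) ^ 2 / 2 := by
      calc E * l * ((∑ i, u i - n * m) ^ 2 / n) ≤ n / 2 * ((∑ i, u i - n * m) ^ 2 / n) := by gcongr
        _ = _ := by field_simp
    have h4 : (∑ i, u i - n * m) ^ 2 ≤ 2 * E * l * (n * s2 + l) := by
      rw [hXeq] at key1
      linarith
    calc ((∑ i, u i) / n - m) ^ 2 = (∑ i, u i - n * m) ^ 2 / n ^ 2 := by field_simp
      _ ≤ 2 * E * l * (n * s2 + l) / n ^ 2 := by gcongr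
      _ = _ := by field_simp
  · have h3 : n * s2 ≤ 2 * (n * v) + 2 * D * l := by
      have : 0 ≤ (∑ i, u i - n * m) ^ 2 / n := by positivity
      have e2 : 0 ≤ D * l := by positivity
      linarith [k.2]
    rw [← mul_le_mul_iff_right₀ hn0]
    refine h3.trans (le_of_eq ?_)
    field_simp

/-- Uniformly over a countable bounded class, means are estimated with an error governed by the
sample variance, and sample variances are bounded by second moments. -/
theorem pi_not_forall_sampleVariance_bounds_le {Z : Type*} [MeasurableSpace Z] (R : Measure Z)
    [IsProbabilityMeasure R] {n : ℕ} (hn : 1 ≤ n) {F : Set (Z → ℝ)} (hF : F.Countable)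
    (hmeas : ∀ f ∈ F, Measurable f) {Y : ℝ} (hFY : ∀ f ∈ F, ∀ᵐ z ∂(R), |f z| ≤ Y)
    {good : Set Z} (hgood : ∀ᵐ z ∂(R), z ∈ good) {N q l C D E : ℝ} (hq : 0 ≤ q) (hl : 1 ≤ l)
    (hC : C = 4 + 5 * √q) (hD : D = 36 * Y ^ 2 * C ^ 2 + 2 * C) (hE : E = C ^ 2 * (8 + 4 * D))
    (hln : E * l ≤ n / 2)
    (hcov : ∀ z z' : Fin n → Z, (∀ i, z i ∈ good) → (∀ i, z' i ∈ good) →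
      ∃ s : Finset (Z → ℝ), (s.card : ℝ) ≤ N ∧
        ∀ f ∈ F, ∃ h ∈ s, ∑ i, (|f (z i) - h (z i)| + |f (z' i) - h (z' i)|) ≤ 2 / n)
    (hcov2 : ∀ z z' : Fin n → Z, (∀ i, z i ∈ good) → (∀ i, z' i ∈ good) →
      ∃ s : Finset (Z → ℝ), (s.card : ℝ) ≤ N ∧
        ∀ f ∈ (fun (f : Z → ℝ) z => (f z - ∫ x, f x ∂(R)) ^ 2) '' F,
          ∃ h ∈ s, ∑ i, (|f (z i) - h (z i)| + |f (z' i) - h (z' i)|) ≤ 2 / n) :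
    (Measure.pi fun _ : Fin n => R) {z | ¬ ∀ f ∈ F,
        ((∑ i, f (z i)) / n - ∫ x, f x ∂(R)) ^ 2 ≤ 2 * E * (l / n) *
          ((∑ i, f (z i) ^ 2) / n - ((∑ i, f (z i)) / n) ^ 2 + l / n) ∧
        (∑ i, f (z i) ^ 2) / n - ((∑ i, f (z i)) / n) ^ 2 ≤
          2 * ∫ x, f x ^ 2 ∂(R) + 2 * D * (l / n)}
      ≤ 4 * ENNReal.ofReal (2 * N * Real.exp (-(q * l) / 2)) := by
  have hLp : ∀ f ∈ F, MemLp f 2 R := fun f hf =>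
    MemLp.of_bound (hmeas f hf).aestronglyMeasurable Y (hFY f hf)
  have hmean : ∀ f ∈ F, |∫ x, f x ∂(R)| ≤ Y := by
    intro f hf
    have := norm_integral_le_of_norm_le_const (μ := R) (f := f) (C := Y) (hFY f hf)
    simpa using this
  have hsq : ∀ f ∈ F, ∀ z, |f z| ≤ Y → (f z - ∫ x, f x ∂(R)) ^ 2 ≤ 4 * Y ^ 2 := by
    intro f hf z hz
    have h1 := hmean f hf
    have : |f z - ∫ x, f x ∂(R)| ≤ 2 * Y := (abs_sub _ _).trans (by linarith)
    calc _ = |f z - ∫ x, f x ∂(R)| ^ 2 := (sq_abs _).symm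
      _ ≤ (2 * Y) ^ 2 := by gcongr
      _ = _ := by ring
  set H := (fun (f : Z → ℝ) z => (f z - ∫ x, f x ∂(R)) ^ 2) '' F with hH
  have hHmeas : ∀ h ∈ H, Measurable h := by
    rintro _ ⟨f, hf, rfl⟩
    have := hmeas f hf
    fun_prop
  have hHb : ∀ f ∈ F, ∀ᵐ z ∂(R), ‖(f z - ∫ x, f x ∂(R)) ^ 2‖ ≤ 4 * Y ^ 2 := fun f hf =>
    (hFY f hf).mono fun z hz => by
      rw [Real.norm_of_nonneg (sq_nonneg _)]; exact hsq f hf z hz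
  have hHLp : ∀ h ∈ H, MemLp h 2 R := by
    rintro _ ⟨f, hf, rfl⟩
    exact MemLp.of_bound (hHmeas _ ⟨f, hf, rfl⟩).aestronglyMeasurable _ (hHb f hf)
  -- The deviation inequality is used twice, for the functions and for their centered squares; the
  -- second use replaces the population variance.
  have b1 := pi_exists_deviation_le R hn hF hmeas hLp hgood hq hl hcov
  have b2 := pi_exists_deviation_le R hn (hF.image _) hHmeas hHLp hgood hq hl hcov2
  set μ := Measure.pi fun _ : Fin n => R with hμ
  set B1 : Set (Fin n → Z) := {z | ∃ f ∈ F, (4 + 5 * √q) * √l *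
        (√(∑ i, (f (z i) - ∫ x, f x ∂(R)) ^ 2) + √(n * Var[f; R] + l))
        < |∑ i, f (z i) - n * ∫ x, f x ∂(R)|}
  set B2 : Set (Fin n → Z) := {z | ∃ f ∈ H, (4 + 5 * √q) * √l *
        (√(∑ i, (f (z i) - ∫ x, f x ∂(R)) ^ 2) + √(n * Var[f; R] + l))
        < |∑ i, f (z i) - n * ∫ x, f x ∂(R)|}
  have hbd : ∀ᵐ z ∂μ, ∀ i, ∀ f ∈ F, |f (z i)| ≤ Y := by
    rw [ae_all_iff]
    intro i
    have : ∀ᵐ z ∂(R), ∀ f ∈ F, |f z| ≤ Y := (ae_ball_iff hF).2 hFY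
    exact (measurePreserving_eval (fun _ : Fin n => R) i).quasiMeasurePreserving.ae this
  have hsub : {z : Fin n → Z | ¬ ∀ f ∈ F,
        ((∑ i, f (z i)) / n - ∫ x, f x ∂(R)) ^ 2 ≤ 2 * E * (l / n) *
          ((∑ i, f (z i) ^ 2) / n - ((∑ i, f (z i)) / n) ^ 2 + l / n) ∧
        (∑ i, f (z i) ^ 2) / n - ((∑ i, f (z i)) / n) ^ 2 ≤
          2 * ∫ x, f x ^ 2 ∂(R) + 2 * D * (l / n)} ⊆
      (B1 ∪ B2) ∪ {z | ¬ ∀ i, ∀ f ∈ F, |f (z i)| ≤ Y} := by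
    intro z hz
    by_contra hcon
    apply hz
    intro f hf
    simp only [Set.mem_union, not_or] at hcon
    obtain ⟨⟨hz1, hz2⟩, hz3⟩ := hcon
    have hz3' : ∀ i, ∀ f ∈ F, |f (z i)| ≤ Y := by
      by_contra h
      exact hz3 h
    have h1 := not_lt.1 fun h => hz1 ⟨f, hf, h⟩
    have h2 := not_lt.1 fun h => hz2 ⟨_, ⟨f, hf, rfl⟩, h⟩
    have hvar : ∫ x, (f x - ∫ x, f x ∂(R)) ^ 2 ∂(R) = Var[f; R] :=
      (variance_eq_integral (hmeas f hf).aemeasurable).symm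
    rw [hvar] at h2
    have hvY : Var[f; R] ≤ 4 * Y ^ 2 := by
      have := norm_integral_le_of_norm_le_const (μ := R) (hHb f hf)
      rw [hvar, Real.norm_of_nonneg (variance_nonneg _ _)] at this
      simpa using this
    have hint : Integrable (fun x => (f x - ∫ x, f x ∂(R)) ^ 2) R :=
      (hHLp _ ⟨f, hf, rfl⟩).integrable one_le_two
    have hvh : Var[fun x => (f x - ∫ x, f x ∂(R)) ^ 2; R] ≤ 4 * Y ^ 2 * Var[f; R] := by
      refine (variance_le_expectation_sq (hHmeas _ ⟨f, hf, rfl⟩).aestronglyMeasurable).trans ?_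
      rw [← hvar, ← integral_const_mul]
      refine integral_mono_ae ((hHLp _ ⟨f, hf, rfl⟩).integrable_sq) (hint.const_mul _) ?_
      refine (hFY f hf).mono fun x hx => ?_
      have := hsq f hf x hx
      have h0 := sq_nonneg (f x - ∫ x, f x ∂(R))
      simp only [Pi.pow_apply]
      nlinarith
    have hv2 : Var[f; R] ≤ ∫ x, f x ^ 2 ∂(R) := by
      simpa using variance_le_expectation_sq (μ := R) (hmeas f hf).aestronglyMeasurable
    have key := sampleVariance_bounds hn (C := C) (l := l) (by rw [hC]; positivity) (by linarith)
      (fun i => f (z i)) (fun i => hsq f hf _ (hz3' i f hf)) (variance_nonneg f R) hvY hvh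
      (by rw [hC]; exact h1) (by rw [hC]; exact h2) (by rw [← hD, ← hE]; exact hln)
    rw [← hD, ← hE] at key
    exact ⟨key.1, key.2.trans (add_le_add (mul_le_mul_of_nonneg_left hv2 zero_le_two) le_rfl)⟩
  have hnull : μ {z | ¬ ∀ i, ∀ f ∈ F, |f (z i)| ≤ Y} = 0 := hbd
  calc μ _ ≤ μ ((B1 ∪ B2) ∪ {z | ¬ ∀ i, ∀ f ∈ F, |f (z i)| ≤ Y}) := measure_mono hsub
    _ ≤ (μ B1 + μ B2) + μ {z | ¬ ∀ i, ∀ f ∈ F, |f (z i)| ≤ Y} :=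
        (measure_union_le _ _).trans (by gcongr; exact measure_union_le _ _)
    _ ≤ (2 * ENNReal.ofReal (2 * N * Real.exp (-(q * l) / 2)) +
        2 * ENNReal.ofReal (2 * N * Real.exp (-(q * l) / 2))) + 0 := by
        rw [hnull]; gcongr
    _ = _ := by ring

/-! ### Uniform control of the weighted moments -/

/-- Uniform bounds on the errors of the sample means and on the sample variances of the moments
weighted by instruments. -/
def GoodDeviations {d n : ℕ} (ylo yhi : ℝ) (Θ : Set ℝ) (𝒢 : Set (Euc d → Fin 2 → ℝ)) (C : ℝ)
    (R : Measure (Obs d)) (o : Fin n → Obs d) : Prop :=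
  ∀ j, ∀ θ ∈ Θ, ∀ g ∈ 𝒢,
    (muHat ylo yhi o θ g j - ∫ x, weighted ylo yhi θ g j x ∂(R)) ^ 2 ≤
      C * (Real.log n / n) * (sigmaHat ylo yhi o θ g j ^ 2 + Real.log n / n) ∧
    sigmaHat ylo yhi o θ g j ^ 2 ≤
      C * (∫ x, weighted ylo yhi θ g j x ^ 2 ∂(R) + Real.log n / n)

/-- Cauchy–Schwarz. It ensures that the square root in `sigmaHat` loses nothing. -/
theorem sampleVariance_nonneg {n : ℕ} (u : Fin n → ℝ) :
    0 ≤ (∑ i, u i ^ 2) / n - ((∑ i, u i) / n) ^ 2 := by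
  rcases Nat.eq_zero_or_pos n with h | h
  · subst h; simp
  have hn : (0 : ℝ) < n := by exact_mod_cast h
  have := sq_sum_le_card_mul_sum_sq (s := Finset.univ) (f := u)
  simp only [Finset.card_univ, Fintype.card_fin] at this
  rw [div_pow, sub_nonneg, div_le_div_iff₀ (by positivity) hn]
  nlinarith

theorem sigmaHat_sq {d n : ℕ} (ylo yhi : ℝ) (o : Fin n → Obs d) (θ : ℝ) (g : Euc d → Fin 2 → ℝ)
    (j : Fin 2) : sigmaHat ylo yhi o θ g j ^ 2 =
      (∑ i, weighted ylo yhi θ g j (o i) ^ 2) / n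
        - ((∑ i, weighted ylo yhi θ g j (o i)) / n) ^ 2 :=
  Real.sq_sqrt (sampleVariance_nonneg _)

/-- It suffices to check `GoodDeviations` on sequentially dense subclasses. -/
theorem GoodDeviations.of_dense {d n : ℕ} {ylo yhi Y C : ℝ} {Θ Θ₀ : Set ℝ}
    {𝒢 𝒢₀ : Set (Euc d → Fin 2 → ℝ)} {R : Measure (Obs d)} [IsProbabilityMeasure R]
    {o : Fin n → Obs d} (h : GoodDeviations ylo yhi Θ₀ 𝒢₀ C R o)
    (hΘ₀ : Θ₀ ⊆ Θ) (hΘ : Θ ⊆ closure Θ₀) (h𝒢₀ : 𝒢₀ ⊆ 𝒢) (hmeas : ∀ g ∈ 𝒢, Measurable g)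
    (h𝒢 : ∀ g ∈ 𝒢, ∃ u : ℕ → Euc d → Fin 2 → ℝ,
      (∀ k, u k ∈ 𝒢₀) ∧ ∀ x, Tendsto (fun k => u k x) atTop (𝓝 (g x)))
    (hY : ∀ θ ∈ Θ, ∀ g ∈ 𝒢, ∀ j, ∀ᵐ z ∂(R), |weighted ylo yhi θ g j z| ≤ Y) :
    GoodDeviations ylo yhi Θ 𝒢 C R o := by
  intro j θ hθ g hg
  obtain ⟨t, ht, htθ⟩ := mem_closure_iff_seq_limit.1 (hΘ hθ)
  obtain ⟨u, hu, hug⟩ := h𝒢 g hg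
  have hw : ∀ z, Tendsto (fun k => weighted ylo yhi (t k) (u k) j z) atTop
      (𝓝 (weighted ylo yhi θ g j z)) := by
    intro z
    refine Tendsto.mul ?_ ?_
    · unfold moment
      split_ifs
      · exact htθ.sub_const _
      · exact htθ.const_sub _
    · exact (tendsto_pi_nhds.1 (hug z.X)) j
  have hmw : ∀ k, Measurable (weighted ylo yhi (t k) (u k) j) := fun k =>
    measurable_weighted _ _ _ (hmeas _ (h𝒢₀ (hu k))) j
  have hbw : ∀ k, ∀ᵐ z ∂(R), |weighted ylo yhi (t k) (u k) j z| ≤ Y := fun k =>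
    hY _ (hΘ₀ (ht k)) _ (h𝒢₀ (hu k)) j
  have hint : Tendsto (fun k => ∫ x, weighted ylo yhi (t k) (u k) j x ∂(R)) atTop
      (𝓝 (∫ x, weighted ylo yhi θ g j x ∂(R))) :=
    tendsto_integral_of_dominated_convergence (fun _ => Y)
      (fun k => (hmw k).aestronglyMeasurable) (integrable_const _) hbw
      (Eventually.of_forall hw)
  have hint2 : Tendsto (fun k => ∫ x, weighted ylo yhi (t k) (u k) j x ^ 2 ∂(R)) atTop
      (𝓝 (∫ x, weighted ylo yhi θ g j x ^ 2 ∂(R))) := by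
    refine tendsto_integral_of_dominated_convergence (fun _ => Y ^ 2)
      (fun k => ((hmw k).pow_const 2).aestronglyMeasurable) (integrable_const _)
      (fun k => (hbw k).mono fun z hz => ?_)
      (Eventually.of_forall fun z => (hw z).pow 2)
    rw [norm_pow]
    exact pow_le_pow_left₀ (norm_nonneg _) hz 2
  have hmu : Tendsto (fun k => muHat ylo yhi o (t k) (u k) j) atTop
      (𝓝 (muHat ylo yhi o θ g j)) :=
    (tendsto_finsetSum _ fun i _ => hw (o i)).div_const _
  have hsig : Tendsto (fun k => sigmaHat ylo yhi o (t k) (u k) j ^ 2) atTop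
      (𝓝 (sigmaHat ylo yhi o θ g j ^ 2)) := by
    simp_rw [sigmaHat_sq]
    exact ((tendsto_finsetSum _ fun i _ => (hw (o i)).pow 2).div_const _).sub
      (((tendsto_finsetSum _ fun i _ => hw (o i)).div_const _).pow 2)
  exact ⟨le_of_tendsto_of_tendsto' ((hmu.sub hint).pow 2)
      ((hsig.add_const _).const_mul _) fun k => (h j _ (ht k) _ (hu k)).1,
    le_of_tendsto_of_tendsto' hsig ((hint2.add_const _).const_mul _)
      fun k => (h j _ (ht k) _ (hu k)).2⟩

/-- The net has at most A n^(2V) points. The choice q = 4V + 2 makes the tail n^(-2V-1), which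
leaves a factor 1/n. -/
theorem card_bound_mul_exp {A V : ℝ} {n : ℕ} (hn : 1 ≤ n) :
    2 * (A * (1 / (n : ℝ) ^ 2) ^ (-V)) * Real.exp (-((4 * V + 2) * Real.log n) / 2)
      = 2 * A / n := by
  have hn0 : (0 : ℝ) < n := by positivity
  have h1 : Real.exp (-((4 * V + 2) * Real.log n) / 2) = (n : ℝ) ^ (-(2 * V) - 1) := by
    rw [Real.rpow_def_of_pos hn0]; congr 1; ring
  have h2 : (1 / (n : ℝ) ^ 2) ^ (-V) = (n : ℝ) ^ (2 * V) := by
    rw [one_div, ← Real.rpow_natCast, ← Real.rpow_neg hn0.le, ← Real.rpow_mul hn0.le]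
    congr 1
    push_cast
    ring
  rw [h1, h2, mul_assoc, mul_assoc, ← Real.rpow_add hn0]
  rw [show 2 * V + (-(2 * V) - 1) = -1 by ring, Real.rpow_neg_one]
  field_simp

theorem goodDeviations_of_sampleVariance_bounds {d n : ℕ} {ylo yhi : ℝ} {Θ : Set ℝ}
    {𝒢 : Set (Euc d → Fin 2 → ℝ)} {R : Measure (Obs d)} {D E C : ℝ} {o : Fin n → Obs d}
    (hC2 : 2 ≤ C) (hCD : 2 * D ≤ C) (hCE : 2 * E ≤ C) (_ : 0 ≤ Real.log n)
    (h : ∀ j, ∀ f ∈ {f | ∃ θ ∈ Θ, ∃ g ∈ 𝒢, f = weighted ylo yhi θ g j},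
        ((∑ i, f (o i)) / n - ∫ x, f x ∂(R)) ^ 2 ≤ 2 * E * (Real.log n / n) *
          ((∑ i, f (o i) ^ 2) / n - ((∑ i, f (o i)) / n) ^ 2 + Real.log n / n) ∧
        (∑ i, f (o i) ^ 2) / n - ((∑ i, f (o i)) / n) ^ 2 ≤
          2 * ∫ x, f x ^ 2 ∂(R) + 2 * D * (Real.log n / n)) :
    GoodDeviations ylo yhi Θ 𝒢 C R o := by
  intro j θ hθ g hg
  obtain ⟨h1, h2⟩ := h j _ ⟨θ, hθ, g, hg, rfl⟩
  have hln : 0 ≤ Real.log n / n := by positivity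
  rw [sigmaHat_sq]
  have h0 := sampleVariance_nonneg fun i => weighted ylo yhi θ g j (o i)
  constructor
  · refine h1.trans ?_
    gcongr
  · refine h2.trans ?_
    rw [mul_add]
    have : 0 ≤ ∫ x, weighted ylo yhi θ g j x ^ 2 ∂(R) := integral_nonneg fun x => sq_nonneg _
    gcongr

/-- The order of quantifiers matters: C is fixed from V and Y before the model, the instruments and
A. Uniformity in P comes from an explicit bound 8 · 2A/n that does not involve P. -/
theorem tendsto_iSup_not_goodDeviations {V Y : ℝ} (hV : 0 < V) :
    ∃ C : ℝ, 0 < C ∧ ∀ (d : ℕ) (ylo yhi : ℝ) (Θ : Set ℝ) (𝓜 : Set (Measure (Latent d)))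
      (𝒢 : Set (Euc d → Fin 2 → ℝ)) (A : ℝ), 0 < A →
      (∀ P ∈ 𝓜, IsSelectionModel ylo yhi P) → PointwiseMeasurable 𝒢 →
      BoundedMoments ylo yhi Θ 𝓜 𝒢 Y → PolynomialCovering ylo yhi Θ 𝒢 Y A V →
      Tendsto (fun n => ⨆ P ∈ 𝓜, sampleLaw P n
        {o | ¬ GoodDeviations ylo yhi Θ 𝒢 C (obsLaw P) o}) atTop (𝓝 0) := by
  obtain ⟨q, hq⟩ : ∃ q, q = 4 * V + 2 := ⟨_, rfl⟩
  obtain ⟨C₀, hC₀⟩ : ∃ C₀, C₀ = 4 + 5 * √q := ⟨_, rfl⟩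
  obtain ⟨D, hD⟩ : ∃ D, D = 36 * Y ^ 2 * C₀ ^ 2 + 2 * C₀ := ⟨_, rfl⟩
  obtain ⟨E, hE⟩ : ∃ E, E = C₀ ^ 2 * (8 + 4 * D) := ⟨_, rfl⟩
  have hC₀0 : 0 < C₀ := by rw [hC₀]; positivity
  have hD0 : 0 < D := by rw [hD]; positivity
  have hE0 : 0 < E := by rw [hE]; positivity
  refine ⟨2 + 2 * D + 2 * E, by positivity, fun d ylo yhi Θ 𝓜 𝒢 A hA hmod hpm hbm hpc => ?_⟩
  obtain ⟨hmeas, 𝒢₀, h𝒢₀, hcount, hdense⟩ := hpm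
  -- The probability bounds need a countable class. Both inequalities of `GoodDeviations` are closed
  -- and pass to limits in θ and g.
  obtain ⟨s, hsc, hsd⟩ := TopologicalSpace.exists_countable_dense Θ
  set Θ₀ : Set ℝ := Subtype.val '' s with hΘ₀
  have hΘ₀c : Θ₀.Countable := hsc.image _
  have hΘ₀sub : Θ₀ ⊆ Θ := by rintro _ ⟨x, _, rfl⟩; exact x.2
  have hΘcl : Θ ⊆ closure Θ₀ := by
    intro θ hθ
    have := image_closure_subset_closure_image (s := s) continuous_subtype_val
    exact this ⟨⟨θ, hθ⟩, hsd _, rfl⟩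
  set F : Fin 2 → Set (Obs d → ℝ) := fun j =>
    {f | ∃ θ ∈ Θ₀, ∃ g ∈ 𝒢₀, f = weighted ylo yhi θ g j} with hF
  have hFc : ∀ j, (F j).Countable := by
    intro j
    have : F j = Set.image2 (fun θ g => weighted ylo yhi θ g j) Θ₀ 𝒢₀ := by
      ext f
      simp only [hF, Set.mem_image2, eq_comm]
      rfl
    rw [this]
    exact hΘ₀c.image2 hcount _
  have hl : ∀ᶠ n : ℕ in atTop, 1 ≤ Real.log n :=
    (Real.tendsto_log_atTop.comp tendsto_natCast_atTop_atTop).eventually_ge_atTop 1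
  have hln : ∀ᶠ n : ℕ in atTop, E * Real.log n ≤ n / 2 := by
    have h1 := (Real.isLittleO_log_id_atTop.comp_tendsto
      (tendsto_natCast_atTop_atTop (R := ℝ))).bound (c := 1 / (2 * E)) (by positivity)
    filter_upwards [h1, hl] with n hn hl
    simp only [Function.comp, id, Real.norm_natCast] at hn
    rw [Real.norm_of_nonneg (by linarith)] at hn
    calc E * Real.log n ≤ E * (1 / (2 * E) * n) := by gcongr
      _ = n / 2 := by field_simp
  have hbound : ∀ᶠ n : ℕ in atTop, ⨆ P ∈ 𝓜, sampleLaw P n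
        {o | ¬ GoodDeviations ylo yhi Θ 𝒢 (2 + 2 * D + 2 * E) (obsLaw P) o}
        ≤ 8 * ENNReal.ofReal (2 * A / n) := by
    filter_upwards [hl, hln, eventually_ge_atTop 2] with n hl hln hn2
    refine iSup₂_le fun P hP => ?_
    have := (hmod P hP).isProbabilityMeasure_obsLaw
    have hr := (hmod P hP).ae_inRange
    have hFm : ∀ j, ∀ f ∈ F j, Measurable f := by
      rintro j _ ⟨θ, _, g, hg, rfl⟩
      exact measurable_weighted _ _ _ (hmeas g (h𝒢₀ hg)) j
    have hFb : ∀ j, ∀ f ∈ F j, ∀ᵐ z ∂(obsLaw P), |f z| ≤ Y := by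
      rintro j _ ⟨θ, hθ, g, hg, rfl⟩
      exact hbm P hP θ (hΘ₀sub hθ) g (h𝒢₀ hg) j
    have hnet : ∀ j, ∀ F' ∈ ({affineClass ylo yhi Θ 𝒢 Y j, squareClass ylo yhi Θ 𝒢 Y j} :
        Set (Set (Obs d → ℝ))), ∀ G ⊆ F', ∀ z z' : Fin n → Obs d,
        (∀ i, z i ∈ inRange ylo yhi) → (∀ i, z' i ∈ inRange ylo yhi) →
        ∃ s : Finset (Obs d → ℝ), (s.card : ℝ) ≤ A * (1 / (n : ℝ) ^ 2) ^ (-V) ∧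
        ∀ f ∈ G, ∃ h ∈ s, ∑ i, (|f (z i) - h (z i)| + |f (z' i) - h (z' i)|) ≤ 2 / n := by
      intro j F' hF' G hG z z' hz hz'
      obtain ⟨s, hs, hs'⟩ := exists_net_of_covering (hpc j F' hF') hA hn2 z z' hz hz'
      exact ⟨s, hs, fun f hf => hs' f (hG hf)⟩
    have hj : ∀ j, _ := fun j => pi_not_forall_sampleVariance_bounds_le (obsLaw P)
      (n := n) (by omega) (hFc j) (hFm j) (hFb j) hr (l := Real.log n)
      (by positivity : (0 : ℝ) ≤ 4 * V + 2) hl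
      (by rw [hC₀, hq]) hD hE hln
      (hnet j _ (Set.mem_insert _ _) _ (by
        rintro _ ⟨θ, hθ, g, hg, rfl⟩
        exact ⟨θ, hΘ₀sub hθ, g, h𝒢₀ hg, 1, 0, by simp, by simp, by simp⟩))
      -- Centered squares are squares of affine members with s = 1 and t equal to minus the mean;
      -- this shift is admissible because the mean is at most Y in absolute value.
      (hnet j _ (Set.mem_insert_of_mem _ rfl) _ (by
        rintro _ ⟨_, ⟨θ, hθ, g, hg, rfl⟩, rfl⟩
        refine ⟨_, ⟨θ, hΘ₀sub hθ, g, h𝒢₀ hg, 1,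
          -∫ x, weighted ylo yhi θ g j x ∂(obsLaw P), by simp, ?_, rfl⟩, by
            ext o; simp only [one_mul]; ring⟩
        rw [abs_neg]
        refine le_trans ?_ (le_max_left _ _)
        have := norm_integral_le_of_norm_le_const (μ := obsLaw P)
          (f := weighted ylo yhi θ g j) (C := Y)
          (hFb j _ ⟨θ, hθ, g, hg, rfl⟩)
        simpa using this))
    simp only [card_bound_mul_exp (show 1 ≤ n by omega)] at hj
    refine le_trans (measure_mono ?_) ((measure_union_le _ _).trans
      ((add_le_add (hj 0) (hj 1)).trans (le_of_eq ?_)))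
    · intro o ho
      by_contra hcon
      simp only [Set.mem_union, not_or] at hcon
      apply ho
      refine GoodDeviations.of_dense (Y := Y) ?_ hΘ₀sub hΘcl h𝒢₀ hmeas hdense
        (fun θ hθ g hg j => hbm P hP θ hθ g hg j)
      refine goodDeviations_of_sampleVariance_bounds (D := D) (E := E) (by linarith)
        (by linarith) (by linarith) (by linarith) ?_
      intro j
      fin_cases j
      · by_contra h; exact hcon.1 h
      · by_contra h; exact hcon.2 h
    · rw [← add_mul]; norm_num
  refine tendsto_of_tendsto_of_tendsto_of_le_of_le' tendsto_const_nhds ?_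
    (Eventually.of_forall fun n => zero_le) hbound
  have h1 : Tendsto (fun n : ℕ => 2 * A / (n : ℝ)) atTop (𝓝 0) :=
    tendsto_const_nhds.div_atTop tendsto_natCast_atTop_atTop
  have h2 := ENNReal.Tendsto.const_mul (a := 8) (ENNReal.tendsto_ofReal h1) (Or.inr (by simp))
  simpa using h2

/-! ### Coverage of the identified set -/

theorem integral_mul_comp_X {d : ℕ} {R : Measure (Obs d)} [IsProbabilityMeasure R] {f : Obs d → ℝ}
    (hf : Integrable f R) {φ : Euc d → ℝ} (hφ : Measurable φ) {M : ℝ} (hM : ∀ x, |φ x| ≤ M) :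
    ∫ o, f o * φ o.X ∂(R) = ∫ o, condX R f o * φ o.X ∂(R) ∧
      Integrable (fun o => condX R f o * φ o.X) R ∧ Integrable (fun o => f o * φ o.X) R := by
  have hm : MeasurableSpace.comap (Obs.X (d := d)) inferInstance ≤
    (inferInstance : MeasurableSpace (Obs d)) := measurable_X.comap_le
  have hφm : StronglyMeasurable[MeasurableSpace.comap (Obs.X (d := d)) inferInstance]
      (fun o : Obs d => φ o.X) :=
    (hφ.comp (comap_measurable Obs.X)).stronglyMeasurable
  have hφR : AEStronglyMeasurable (fun o : Obs d => φ o.X) R :=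
    (hφ.comp measurable_X).aestronglyMeasurable
  have hb : ∀ᵐ o ∂(R), ‖φ o.X‖ ≤ M := Eventually.of_forall fun o => hM _
  have hfφ : Integrable (fun o => f o * φ o.X) R := hf.mul_bdd hφR hb
  refine ⟨?_, integrable_condExp.mul_bdd hφR hb, hfφ⟩
  have h := condExp_mul_of_stronglyMeasurable_right (μ := R) hφm hfφ hf
  rw [← integral_condExp hm]
  exact integral_congr_ae h

theorem IsSelectionModel.integrable_fill {d : ℕ} {ylo yhi : ℝ} {P : Measure (Latent d)}
    (h : IsSelectionModel ylo yhi P) :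
    Integrable (fill ylo) (obsLaw P) ∧ Integrable (fill yhi) (obsLaw P) := by
  have := h.isProbabilityMeasure_obsLaw
  have hb : ∀ x ∈ Set.Icc ylo yhi, ‖x‖ ≤ max |ylo| |yhi| := fun x hx => abs_le_max_abs_abs hx.1 hx.2
  exact ⟨Integrable.of_bound (measurable_fill _).aestronglyMeasurable _
      (h.ae_inRange.mono fun o ho => hb _ ho.1),
    Integrable.of_bound (measurable_fill _).aestronglyMeasurable _
      (h.ae_inRange.mono fun o ho => hb _ ho.2)⟩

theorem IsSelectionModel.integrable_moment {d : ℕ} {ylo yhi : ℝ} {P : Measure (Latent d)}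
    (h : IsSelectionModel ylo yhi P) (j : Fin 2) (θ : ℝ) :
    Integrable (moment ylo yhi j θ) (obsLaw P) := by
  have := h.isProbabilityMeasure_obsLaw
  unfold moment
  split_ifs
  · exact (integrable_const θ).sub h.integrable_fill.1
  · exact h.integrable_fill.2.sub (integrable_const θ)

/-- On the identified set, moments weighted by nonnegative instruments have nonnegative means. -/
theorem integral_weighted_nonneg {d : ℕ} {ylo yhi : ℝ} {Θ : Set ℝ} {P : Measure (Latent d)}
    (h : IsSelectionModel ylo yhi P) {θ : ℝ} (hθ : θ ∈ identifiedSet ylo yhi Θ P)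
    {g : Euc d → Fin 2 → ℝ} (hg : Measurable g) {M : ℝ} (hM : ∀ x j, |g x j| ≤ M)
    (hg0 : ∀ j, ∀ᵐ o ∂(obsLaw P), 0 ≤ g o.X j) (j : Fin 2) :
    0 ≤ ∫ o, weighted ylo yhi θ g j o ∂(obsLaw P) := by
  have := h.isProbabilityMeasure_obsLaw
  have h1 := (integral_mul_comp_X (h.integrable_moment j θ)
    ((measurable_pi_apply j).comp hg) fun x => hM x j).1
  refine le_trans ?_ (le_of_eq h1.symm)
  refine integral_nonneg_of_ae ?_
  filter_upwards [hθ.2 j, hg0 j] with o h1 h2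
  exact mul_nonneg h1 h2

/-- Eliminates the extended-real supremum: membership is tested instrument by instrument, at the
level c L. -/
theorem mem_ksRegion_iff {d n : ℕ} {ylo yhi : ℝ} {Θ : Set ℝ} {𝒢 : Set (Euc d → Fin 2 → ℝ)}
    {S : (Fin 2 → ℝ) → ℝ} {σ c : ℝ} {o : Fin n → Obs d} (hl : 0 < Real.log n) {θ : ℝ} :
    θ ∈ ksRegion ylo yhi Θ 𝒢 S σ c o ↔ θ ∈ Θ ∧ ∀ g ∈ 𝒢,
      S (fun j => muHat ylo yhi o θ g j / max (sigmaHat ylo yhi o θ g j) σ)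
        ≤ c * √(Real.log n / n) := by
  have hn : (0 : ℝ) < n := by
    rcases Nat.eq_zero_or_pos n with h | h
    · simp [h] at hl
    · exact_mod_cast h
  have hr : 0 < √n / √(Real.log n) := by positivity
  have hrr : √n / √(Real.log n) * (c * √(Real.log n / n)) = c := by
    rw [Real.sqrt_div hl.le]; field_simp
  refine and_congr_right fun _ => ⟨fun h g hg => ?_, fun h => ?_⟩
  · have h1 : ((√n / √(Real.log n) : ℝ) : EReal) *
        ((S fun j => muHat ylo yhi o θ g j / max (sigmaHat ylo yhi o θ g j) σ : ℝ) : EReal)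
        ≤ (c : EReal) :=
      le_trans (mul_le_mul_of_nonneg_left
        (le_iSup₂ (f := fun g (_ : g ∈ 𝒢) => ((S fun j => muHat ylo yhi o θ g j /
          max (sigmaHat ylo yhi o θ g j) σ : ℝ) : EReal)) g hg)
        (by exact_mod_cast hr.le)) h
    rw [← EReal.coe_mul, EReal.coe_le_coe_iff] at h1
    rw [← hrr] at h1
    exact le_of_mul_le_mul_left h1 hr
  · have h1 : ksStat ylo yhi 𝒢 S σ o θ ≤ ((c * √(Real.log n / n) : ℝ) : EReal) :=
      iSup₂_le fun g hg => by exact_mod_cast h g hg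
    have h2 := mul_le_mul_of_nonneg_left h1
      (by exact_mod_cast hr.le : (0 : EReal) ≤ ((√n / √(Real.log n) : ℝ) : EReal))
    rwa [← EReal.coe_mul, hrr] at h2

/-- The confidence region covers the identified set when deviations are controlled. -/
theorem identifiedSet_subset_ksRegion {d n : ℕ} {ylo yhi : ℝ} {Θ : Set ℝ} {P : Measure (Latent d)}
    {𝒢 : Set (Euc d → Fin 2 → ℝ)} {S : (Fin 2 → ℝ) → ℝ} {C KS₁ KS₂ K σ c M : ℝ}
    (h : IsSelectionModel ylo yhi P) (hmeas : ∀ g ∈ 𝒢, Measurable g)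
    (hM : ∀ g ∈ 𝒢, ∀ x j, |g x j| ≤ M)
    (hg0 : ∀ g ∈ 𝒢, ∀ j, ∀ᵐ o ∂(obsLaw P), 0 ≤ g o.X j)
    (hS : SCondition S KS₁ KS₂) (hC : 0 ≤ C) (hKS₁ : 0 < KS₁) (hK1 : 1 ≤ K)
    (hK : √(2 * C) < K * KS₁)
    {o : Fin n → Obs d} (hl : 0 < Real.log n) (hgood : GoodDeviations ylo yhi Θ 𝒢 C (obsLaw P) o)
    (hσ : √(Real.log n / n) ≤ σ) (hc : K ≤ c) :
    identifiedSet ylo yhi Θ P ⊆ ksRegion ylo yhi Θ 𝒢 S σ c o := by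
  intro θ hθ
  have hn : (0 : ℝ) < n := by
    rcases Nat.eq_zero_or_pos n with h | h
    · simp [h] at hl
    · exact_mod_cast h
  rw [mem_ksRegion_iff hl]
  refine ⟨hθ.1, fun g hg => ?_⟩
  by_contra hcon
  push Not at hcon
  set L := √(Real.log n / n) with hL
  have hL0 : 0 < L := by positivity
  have hL2 : L ^ 2 = Real.log n / n := Real.sq_sqrt (by positivity)
  -- A violation forces some sample mean below -c L K_{S,1} max(σ̂, σ). Its expectation is
  -- nonnegative, while its error is at most √(2C) L max(σ̂, σ), which is smaller.
  obtain ⟨j, hj⟩ := hS.lower (c * L) (by have : 0 < c := by linarith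
                                         positivity) _ hcon.le
  set s := sigmaHat ylo yhi o θ g j with hs
  have hs0 : 0 ≤ s := Real.sqrt_nonneg _
  have hmax : 0 < max s σ := lt_max_of_lt_right (hL0.trans_le hσ)
  have hμ := integral_weighted_nonneg h hθ (hmeas g hg) (hM g hg) (hg0 g hg) j
  have hdev := (hgood j θ hθ.1 g hg).1
  rw [← hL2, ← hs] at hdev
  rw [div_le_iff₀ hmax] at hj
  have hb : (muHat ylo yhi o θ g j - ∫ x, weighted ylo yhi θ g j x ∂(obsLaw P)) ^ 2
      ≤ (√(2 * C) * L * max s σ) ^ 2 := by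
    refine hdev.trans ?_
    rw [mul_pow, mul_pow, Real.sq_sqrt (show 0 ≤ 2 * C by positivity)]
    have h1 : s ^ 2 ≤ max s σ ^ 2 := by gcongr; exact le_max_left _ _
    have h2 : L ^ 2 ≤ max s σ ^ 2 := by gcongr; exact hσ.trans (le_max_right _ _)
    calc C * L ^ 2 * (s ^ 2 + L ^ 2) ≤ C * L ^ 2 * (max s σ ^ 2 + max s σ ^ 2) := by gcongr
      _ = _ := by ring
  have h3 := (abs_le.1 (abs_le_of_sq_le_sq hb (by positivity))).1
  have h4 : √(2 * C) * L * max s σ < c * L * KS₁ * max s σ := by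
    have : √(2 * C) * (L * max s σ) < (c * KS₁) * (L * max s σ) := by
      refine mul_lt_mul_of_pos_right (hK.trans_le ?_) (by positivity)
      gcongr
    linarith
  linarith

/-! ### From informative instruments to the rate -/

/-- The moments are bounded when 𝒢 contains functions comparable to indicators of large balls. -/
theorem ae_abs_moment_le {d : ℕ} {ylo yhi Y C₁ C₂ : ℝ} {R : Measure (Obs d)}
    {𝒢 : Set (Euc d → Fin 2 → ℝ)} (hC₁ : 0 < C₁) (hC₂ : 0 < C₂)
    (hrich : ∀ (s : Euc d) (t : ℝ), 0 < t → ∃ g ∈ 𝒢, ∀ x j,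
      (Metric.ball s (C₂ * t)).indicator (fun _ => C₁) x ≤ g x j ∧
      g x j ≤ (Metric.ball s t).indicator (fun _ => (1 : ℝ)) x) {θ : ℝ}
    (hY : ∀ g ∈ 𝒢, ∀ j, ∀ᵐ o ∂(R), |weighted ylo yhi θ g j o| ≤ Y) (j : Fin 2) :
    ∀ᵐ o ∂(R), |moment ylo yhi j θ o| ≤ Y / C₁ := by
  choose g hg hgb using fun k : ℕ => hrich 0 (k + 1) (by positivity)
  have h : ∀ᵐ o ∂(R), ∀ k, |weighted ylo yhi θ (g k) j o| ≤ Y :=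
    ae_all_iff.2 fun k => hY _ (hg k) j
  refine h.mono fun o ho => ?_
  obtain ⟨k, hk⟩ := exists_nat_gt (‖o.X‖ / C₂)
  rw [div_lt_iff₀ hC₂] at hk
  have hmem : o.X ∈ Metric.ball (0 : Euc d) (C₂ * (k + 1)) := by
    rw [mem_ball_zero_iff]; linarith
  have h1 := (hgb k o.X j).1
  rw [Set.indicator_of_mem hmem] at h1
  have h2 := ho k
  rw [weighted, abs_mul, abs_of_pos (hC₁.trans_le h1)] at h2
  rw [le_div_iff₀ hC₁]
  exact (mul_le_mul_of_nonneg_left h1 (abs_nonneg _)).trans h2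

/-- Members of the region are close to where the instrument's moment is not too negative. -/
theorem mul_le_of_mem_ksRegion {d n : ℕ} {ylo yhi : ℝ} {Θ : Set ℝ} {R : Measure (Obs d)}
    {𝒢 : Set (Euc d → Fin 2 → ℝ)} {S : (Fin 2 → ℝ) → ℝ} {C KS₁ KS₂ M σ c b G : ℝ}
    (hS : SCondition S KS₁ KS₂) (hKS₂ : 0 < KS₂) (hC : 0 ≤ C) (hM : 0 ≤ M)
    {o : Fin n → Obs d} (hl : 0 < Real.log n) (hgood : GoodDeviations ylo yhi Θ 𝒢 C R o)
    (hσ : √(Real.log n / n) ≤ σ) (hc : 1 ≤ c) {θ : ℝ} (hθ : θ ∈ ksRegion ylo yhi Θ 𝒢 S σ c o)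
    {g : Euc d → Fin 2 → ℝ} (hg : g ∈ 𝒢) {j : Fin 2} (hG : 0 ≤ G)
    (h1 : ∫ x, weighted ylo yhi θ g j x ∂(R) ≤ -(b / 2) * G)
    (h2 : ∫ x, weighted ylo yhi θ g j x ^ 2 ∂(R) ≤ M ^ 2 * G) :
    b * G ≤ 2 * (KS₂ + √C) * (√C * M + √C + 1) * (c * √(Real.log n / n)) * (√G + σ) := by
  have hn : (0 : ℝ) < n := by
    rcases Nat.eq_zero_or_pos n with h | h
    · simp [h] at hl
    · exact_mod_cast h
  rw [mem_ksRegion_iff hl] at hθ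
  have hreg := hθ.2 g hg
  obtain ⟨hd1, hd2⟩ := hgood j θ hθ.1 g hg
  have hL2 : √(Real.log n / n) ^ 2 = Real.log n / n := Real.sq_sqrt (by positivity)
  have hL0 : 0 < √(Real.log n / n) := by positivity
  rw [← hL2] at hd1 hd2
  generalize √(Real.log n / n) = L at *
  have hκ : 0 < c * L := by positivity
  have hup := hS.upper (c * L) hκ _ hreg j
  have hs0 : 0 ≤ sigmaHat ylo yhi o θ g j := Real.sqrt_nonneg _
  generalize sigmaHat ylo yhi o θ g j = s at *
  generalize muHat ylo yhi o θ g j = m at *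
  generalize ∫ x, weighted ylo yhi θ g j x ∂(R) = μ at *
  have hσ0 : 0 < σ := hL0.trans_le hσ
  have hmax : max s σ ≤ s + σ := max_le (by linarith) (by linarith)
  have hmax0 : 0 < max s σ := lt_max_of_lt_right hσ0
  rw [le_div_iff₀ hmax0] at hup
  have hm : -(c * L * KS₂) * (s + σ) ≤ m := by
    have : c * L * KS₂ * max s σ ≤ c * L * KS₂ * (s + σ) := by gcongr
    linarith
  have hr : 0 ≤ √C := Real.sqrt_nonneg _
  have hrC : √C ^ 2 = C := Real.sq_sqrt hC
  generalize √C = r at *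
  subst hrC
  have hdev : m - μ ≤ r * (c * L) * (s + σ) := by
    have h3 : |m - μ| ≤ r * L * (s + L) := by
      refine abs_le_of_sq_le_sq (hd1.trans ?_) (by positivity)
      have : s ^ 2 + L ^ 2 ≤ (s + L) ^ 2 := by nlinarith [mul_nonneg hs0 hL0.le]
      calc r ^ 2 * L ^ 2 * (s ^ 2 + L ^ 2) ≤ r ^ 2 * L ^ 2 * (s + L) ^ 2 := by gcongr
        _ = _ := by ring
    refine (le_abs_self _).trans (h3.trans ?_)
    have : L ≤ c * L := by nlinarith
    gcongr
  have hg0 : 0 ≤ √G := Real.sqrt_nonneg _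
  have hgG : √G ^ 2 = G := Real.sq_sqrt hG
  -- The second moment is at most M² G and L ≤ σ, so the sample standard deviation is of order √G +
  -- σ.
  have hs : s ≤ r * M * √G + r * σ := by
    refine le_of_sq_le_sq ?_ (by positivity)
    calc s ^ 2 ≤ r ^ 2 * (M ^ 2 * G + L ^ 2) := hd2.trans (by gcongr)
      _ ≤ r ^ 2 * (M ^ 2 * G + σ ^ 2) := by gcongr
      _ ≤ (r * M * √G + r * σ) ^ 2 := by
          have : 0 ≤ r * M * √G * (r * σ) := by positivity
          rw [← hgG, Real.sqrt_sq hg0]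
          nlinarith
  have h5 : s + σ ≤ (r * M + r + 1) * (√G + σ) := by
    have e1 : 0 ≤ r * M * σ := by positivity
    have e2 : 0 ≤ r * √G := by positivity
    nlinarith
  have h6 : b / 2 * G ≤ (KS₂ + r) * (c * L) * (s + σ) := by linarith
  have h7 : (KS₂ + r) * (c * L) * (s + σ) ≤
      (KS₂ + r) * (c * L) * ((r * M + r + 1) * (√G + σ)) := by gcongr
  linarith

/-- Solving the bound on the distance for the rate. -/
theorem exists_rate_bound {e C₁ M c₀ : ℝ} (he : 0 ≤ e) (hC₁ : 0 < C₁) (hM : 0 ≤ M)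
    (hc₀ : 0 < c₀) : ∃ B : ℝ, 0 ≤ B ∧ ∀ b G κ σ : ℝ, 0 < b → 0 < κ → c₀ * b ^ e ≤ G →
      σ ≤ M * κ ^ (e / (e + 2)) → b * G ≤ C₁ * κ * (√G + σ) →
      b ≤ B * κ ^ (2 / (e + 2)) := by
  refine ⟨(2 * C₁ / √c₀) ^ (2 / (e + 2)) + (2 * C₁ * M / c₀) ^ (1 / (e + 1)), by positivity,
    fun b G κ σ hb hκ hG hσ h => ?_⟩
  have hbe : 0 < b ^ e := by positivity
  have hG0 : 0 < G := lt_of_lt_of_le (by positivity) hG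
  have hκ1 : 0 < κ ^ (2 / (e + 2)) := by positivity
  rw [add_mul]
  -- If √G dominates, b √G ≲ κ and hence b^((e+2)/2) ≲ κ. If σ dominates, b^(e+1) ≲ κ σ ≲
  -- κ^((2e+2)/(e+2)). Both give the same power of κ.
  rcases le_total σ (√G) with hc | hc
  · have hsG : 0 < √G := Real.sqrt_pos.2 hG0
    have h1 : b * √G ≤ 2 * C₁ * κ := by
      have : b * √G * √G ≤ 2 * C₁ * κ * √G := by
        rw [mul_assoc, Real.mul_self_sqrt hG0.le]
        have : C₁ * κ * (√G + σ) ≤ C₁ * κ * (√G + √G) := by gcongr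
        linarith
      exact le_of_mul_le_mul_right this hsG
    have h2 : √c₀ * b ^ (e / 2) ≤ √G := by
      have : b ^ (e / 2) = √(b ^ e) := by
        rw [Real.sqrt_eq_rpow, ← Real.rpow_mul hb.le]; congr 1; ring
      rw [this, ← Real.sqrt_mul hc₀.le]
      exact Real.sqrt_le_sqrt hG
    have h3 : b ^ ((e + 2) / 2) ≤ 2 * C₁ / √c₀ * κ := by
      have : b ^ ((e + 2) / 2) = b * b ^ (e / 2) := by
        rw [show (e + 2) / 2 = 1 + e / 2 by ring, Real.rpow_add hb, Real.rpow_one]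
      rw [this, div_mul_eq_mul_div, le_div_iff₀ (Real.sqrt_pos.2 hc₀)]
      calc b * b ^ (e / 2) * √c₀ = b * (√c₀ * b ^ (e / 2)) := by ring
        _ ≤ b * √G := by gcongr
        _ ≤ _ := h1
    have h4 : b ≤ (2 * C₁ / √c₀) ^ (2 / (e + 2)) * κ ^ (2 / (e + 2)) := by
      rw [← Real.mul_rpow (by positivity) hκ.le]
      calc b = (b ^ ((e + 2) / 2)) ^ (2 / (e + 2)) := by
            rw [← Real.rpow_mul hb.le]
            rw [show (e + 2) / 2 * (2 / (e + 2)) = 1 by field_simp, Real.rpow_one]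
        _ ≤ _ := by gcongr
    have : 0 ≤ (2 * C₁ * M / c₀) ^ (1 / (e + 1)) * κ ^ (2 / (e + 2)) := by positivity
    linarith
  · have h1 : b * (c₀ * b ^ e) ≤ 2 * C₁ * M * κ ^ ((2 * e + 2) / (e + 2)) := by
      calc b * (c₀ * b ^ e) ≤ b * G := by gcongr
        _ ≤ C₁ * κ * (σ + σ) := h.trans (by gcongr)
        _ ≤ C₁ * κ * (M * κ ^ (e / (e + 2)) + M * κ ^ (e / (e + 2))) := by gcongr
        _ = 2 * C₁ * M * (κ * κ ^ (e / (e + 2))) := by ring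
        _ = _ := by
            rw [show (2 * e + 2) / (e + 2) = 1 + e / (e + 2) by field_simp; ring,
              Real.rpow_add hκ, Real.rpow_one]
    have h3 : b ^ (e + 1) ≤ 2 * C₁ * M / c₀ * κ ^ ((2 * e + 2) / (e + 2)) := by
      rw [Real.rpow_add hb, Real.rpow_one, div_mul_eq_mul_div, le_div_iff₀ hc₀]
      linarith
    have h4 : b ≤ (2 * C₁ * M / c₀) ^ (1 / (e + 1)) * κ ^ (2 / (e + 2)) := by
      calc b = (b ^ (e + 1)) ^ (1 / (e + 1)) := by
            rw [← Real.rpow_mul hb.le, mul_one_div_cancel (by positivity), Real.rpow_one]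
        _ ≤ (2 * C₁ * M / c₀ * κ ^ ((2 * e + 2) / (e + 2))) ^ (1 / (e + 1)) := by gcongr
        _ = _ := by
            rw [Real.mul_rpow (by positivity) (by positivity), ← Real.rpow_mul hκ.le]
            congr 2
            field_simp
    have : 0 ≤ (2 * C₁ / √c₀) ^ (2 / (e + 2)) * κ ^ (2 / (e + 2)) := by positivity
    linarith

/-- How far `θ` lies outside `[γl, γu]` on the side that the `j`-th moment inequality bounds. -/
def excess (γl γu : ℝ) (j : Fin 2) (θ : ℝ) : ℝ := if j = 0 then γl - θ else θ - γu

/-- The identified set is an interval `[γl, γu]`, and each parameter outside of it is rejected by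
an instrument with mass at least `c₀ * b ^ e`, where `b` is the distance to the interval. -/
def HasInformativeInstruments {d : ℕ} (ylo yhi : ℝ) (Θ : Set ℝ) (𝒢 : Set (Euc d → Fin 2 → ℝ))
    (c₀ e : ℝ) (P : Measure (Latent d)) : Prop :=
  ∃ γl γu : ℝ, γl ≤ γu ∧ identifiedSet ylo yhi Θ P = Set.Icc γl γu ∧
    ∀ θ ∈ Θ, ∀ j, 0 < excess γl γu j θ → ∃ g ∈ 𝒢, (∀ x i, 0 ≤ g x i ∧ g x i ≤ 1) ∧
      c₀ * excess γl γu j θ ^ e ≤ ∫ o, g o.X j ∂(obsLaw P) ∧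
      ∫ o, weighted ylo yhi θ g j o ∂(obsLaw P)
        ≤ -(excess γl γu j θ / 2) * ∫ o, g o.X j ∂(obsLaw P)

/-- Since 0 ≤ g ≤ 1, g² ≤ g: the variance of an instrument's moment is at most proportional to its
mass. -/
theorem integral_weighted_sq_le {d : ℕ} {ylo yhi M θ : ℝ} {R : Measure (Obs d)}
    [IsProbabilityMeasure R] {g : Euc d → Fin 2 → ℝ} (hg : Measurable g)
    (hg01 : ∀ x i, 0 ≤ g x i ∧ g x i ≤ 1) {j : Fin 2}
    (hM : ∀ᵐ o ∂(R), |moment ylo yhi j θ o| ≤ M) :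
    ∫ o, weighted ylo yhi θ g j o ^ 2 ∂(R) ≤ M ^ 2 * ∫ o, g o.X j ∂(R) := by
  have hgm : Measurable fun o : Obs d => g o.X j :=
    (measurable_pi_apply j).comp (hg.comp measurable_X)
  have hgi : Integrable (fun o : Obs d => g o.X j) R :=
    Integrable.of_bound hgm.aestronglyMeasurable 1 (Eventually.of_forall fun o => by
      rw [Real.norm_of_nonneg (hg01 _ _).1]; exact (hg01 _ _).2)
  rw [← integral_const_mul]
  refine integral_mono_of_nonneg (Eventually.of_forall fun o => sq_nonneg _) (hgi.const_mul _) ?_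
  refine hM.mono fun o ho => ?_
  have h1 := hg01 o.X j
  have h2 : moment ylo yhi j θ o ^ 2 ≤ M ^ 2 := by
    rw [← sq_abs]; exact pow_le_pow_left₀ (abs_nonneg _) ho 2
  simp only [weighted, mul_pow]
  exact mul_le_mul h2 (by nlinarith [h1.1, h1.2]) (sq_nonneg _) (sq_nonneg _)

theorem hausdorffEDist_le_of_excess_le {A : Set ℝ} {γl γu r : ℝ} (hγ : γl ≤ γu)
    (hsub : Set.Icc γl γu ⊆ A)
    (h : ∀ θ ∈ A, ∀ j, 0 < excess γl γu j θ → excess γl γu j θ ≤ r) :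
    Metric.hausdorffEDist A (Set.Icc γl γu) ≤ ENNReal.ofReal r := by
  refine Metric.hausdorffEDist_le_of_mem_edist (fun θ hθ => ?_)
    fun θ hθ => ⟨θ, hsub hθ, by simp⟩
  rcases lt_or_ge θ γl with h1 | h1
  · refine ⟨γl, ⟨le_rfl, hγ⟩, ?_⟩
    have := h θ hθ 0 (by simp [excess, h1])
    rw [edist_dist, Real.dist_eq, abs_of_neg (by linarith)]
    simp only [excess, if_true] at this
    exact ENNReal.ofReal_le_ofReal (by linarith)
  rcases lt_or_ge γu θ with h2 | h2
  · refine ⟨γu, ⟨hγ, le_rfl⟩, ?_⟩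
    have := h θ hθ 1 (by simp [excess, h2])
    rw [edist_dist, Real.dist_eq, abs_of_pos (by linarith)]
    simp only [excess, one_ne_zero, if_false] at this
    exact ENNReal.ofReal_le_ofReal (by linarith)
  · exact ⟨θ, ⟨h1, h2⟩, by simp⟩

/-- The confidence region converges to the identified set at the rate that the mass of the
informative instruments determines. -/
theorem convergesAtRate_of_hasInformativeInstruments {d : ℕ} {ylo yhi : ℝ} {Θ : Set ℝ}
    {𝓜 : Set (Measure (Latent d))} {𝒢 : Set (Euc d → Fin 2 → ℝ)} {S : (Fin 2 → ℝ) → ℝ}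
    {σ a c : ∀ n : ℕ, (Fin n → Obs d) → ℝ} {Y KS₁ KS₂ K C c₀ e ρ ψ : ℝ}
    (hY : 0 ≤ Y) (hKS₁ : 0 < KS₁) (hKS₂ : 0 < KS₂) (hC : 0 ≤ C) (hK1 : 1 ≤ K)
    (hK : √(2 * C) < K * KS₁)
    (hmod : ∀ P ∈ 𝓜, IsSelectionModel ylo yhi P) (hmeas : ∀ g ∈ 𝒢, Measurable g)
    (hnonneg : NonnegInstruments 𝓜 𝒢) (hbm : BoundedMoments ylo yhi Θ 𝓜 𝒢 Y)
    (hS : SCondition S KS₁ KS₂)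
    (hσa : ∀ n : ℕ, 2 ≤ n → ∀ o, a n o ≤ σ n o * √((n : ℝ) / Real.log n))
    (ha : UnifProbToOne 𝓜 (fun n => {o | K ≤ a n o}))
    (hc : UnifProbToOne 𝓜 (fun n => {o | K ≤ c n o}))
    (hrich : RichInstruments 𝒢)
    (hgood : Tendsto (fun n => ⨆ P ∈ 𝓜, sampleLaw P n
      {o | ¬ GoodDeviations ylo yhi Θ 𝒢 C (obsLaw P) o}) atTop (𝓝 0))
    (he : 0 ≤ e) (hρ : ρ = 1 / (e + 2)) (hψ : ψ = e / (e + 2)) (hc₀ : 0 < c₀)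
    (hinf : ∀ P ∈ 𝓜, HasInformativeInstruments ylo yhi Θ 𝒢 c₀ e P)
    (hrate : CutoffRate 𝓜 σ ψ) :
    ConvergesAtRate ylo yhi Θ 𝓜 𝒢 S σ c ρ := by
  obtain ⟨⟨M, hM⟩, C₁, C₂, hC₁, -, hC₂, -, hballs⟩ := hrich
  obtain ⟨Mσ, hMσ⟩ := hrate
  set M₁ := Y / C₁ with hM₁
  have hM₁0 : 0 ≤ M₁ := by positivity
  obtain ⟨B, hB0, hB⟩ := exists_rate_bound (e := e)
    (C₁ := 2 * (KS₂ + √C) * (√C * M₁ + √C + 1)) (M := |Mσ|) he (by positivity) (abs_nonneg _) hc₀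
  refine ⟨B, ?_⟩
  -- The failure event lies in the union of four events whose uniform probabilities vanish.
  have hsum := ((hgood.add ha).add hc).add hMσ
  simp only [add_zero] at hsum
  refine tendsto_of_tendsto_of_tendsto_of_le_of_le' tendsto_const_nhds hsum
    (Eventually.of_forall fun n => zero_le) ?_
  have hl : ∀ᶠ n : ℕ in atTop, 1 ≤ Real.log n :=
    (Real.tendsto_log_atTop.comp tendsto_natCast_atTop_atTop).eventually_ge_atTop 1
  filter_upwards [hl, eventually_ge_atTop 2] with n hl hn2
  refine iSup₂_le fun P hP => ?_
  refine le_trans (measure_mono (t := (({o | ¬ GoodDeviations ylo yhi Θ 𝒢 C (obsLaw P) o} ∪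
    {o | K ≤ a n o}ᶜ) ∪ {o | K ≤ c n o}ᶜ) ∪
    {o | σ n o * ((n : ℝ) / Real.log n) ^ (ψ / 2) ≤ Mσ}ᶜ) ?_) ?_
  · intro o ho
    by_contra hcon
    simp only [Set.mem_union, not_or] at hcon
    obtain ⟨⟨⟨hg1, ha1⟩, hc1⟩, hs1⟩ := hcon
    have hgd : GoodDeviations ylo yhi Θ 𝒢 C (obsLaw P) o := by by_contra h; exact hg1 h
    have ha' : K ≤ a n o := by by_contra h; exact ha1 h
    have hc' : K ≤ c n o := by by_contra h; exact hc1 h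
    have hs' : σ n o * ((n : ℝ) / Real.log n) ^ (ψ / 2) ≤ Mσ := by by_contra h; exact hs1 h
    refine absurd (show ENNReal.ofReal B < _ from ho) (not_lt.2 ?_)
    have := (hmod P hP).isProbabilityMeasure_obsLaw
    have hn0 : (0 : ℝ) < n := by positivity
    have hl0 : 0 < Real.log n := by linarith
    have hL0 : 0 < √(Real.log n / n) := by positivity
    have hL2 : √(Real.log n / n) ^ 2 = Real.log n / n := Real.sq_sqrt (by positivity)
    have hinv : (n : ℝ) / Real.log n = (√(Real.log n / n) ^ 2)⁻¹ := by rw [hL2, inv_div]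
    have hσ : √(Real.log n / n) ≤ σ n o := by
      have h1 := (hK1.trans ha').trans (hσa n hn2 o)
      rw [hinv, Real.sqrt_inv, Real.sqrt_sq hL0.le, ← div_eq_mul_inv, le_div_iff₀ hL0] at h1
      linarith
    have hcpos : 0 < c n o := by linarith
    set κ := c n o * √(Real.log n / n) with hκ
    have hκ0 : 0 < κ := by positivity
    have hψ0 : 0 ≤ ψ := by rw [hψ]; positivity
    -- The cutoff rate bounds σ by Mσ L^ψ, and c ≥ 1 gives L ≤ κ. The absolute value is needed
    -- because the sign of Mσ is unknown.
    have hσκ : σ n o ≤ |Mσ| * κ ^ (e / (e + 2)) := by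
      rw [← hψ]
      rw [hinv, ← Real.rpow_natCast, ← Real.rpow_neg hL0.le, ← Real.rpow_mul hL0.le,
        show -((2 : ℕ) : ℝ) * (ψ / 2) = -ψ by push_cast; ring, Real.rpow_neg hL0.le,
        ← div_eq_mul_inv, div_le_iff₀ (by positivity)] at hs'
      refine hs'.trans ?_
      have : √(Real.log n / n) ≤ κ := by
        rw [hκ]; nlinarith
      gcongr
      exact le_abs_self _
    obtain ⟨γl, γu, hγ, hid, hθ⟩ := hinf P hP
    have hsub := identifiedSet_subset_ksRegion (hmod P hP) hmeas hM (fun g hg j => hnonneg P hP g hg j)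
      hS hC hKS₁ hK1 hK hl0 hgd hσ hc'
    rw [hid] at hsub ⊢
    have hH := hausdorffEDist_le_of_excess_le hγ
      (r := B * κ ^ (2 / (e + 2))) hsub (by
        intro θ hreg j hj
        obtain ⟨g, hg, hg01, hmass, hmean⟩ := hθ θ hreg.1 j hj
        have hmom := ae_abs_moment_le hC₁ hC₂ hballs
          (fun g hg j => hbm P hP θ hreg.1 g hg j) j
        have hG : 0 ≤ ∫ o, g o.X j ∂(obsLaw P) := integral_nonneg fun o => (hg01 _ _).1
        have key := mul_le_of_mem_ksRegion hS hKS₂ hC hM₁0 hl0 hgd hσ (hK1.trans hc') hreg hg hG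
          hmean (integral_weighted_sq_le (hmeas g hg) hg01 hmom)
        exact hB _ _ κ (σ n o) hj hκ0 hmass hσκ key)
    refine (mul_le_mul_right hH _).trans ?_
    rw [← ENNReal.ofReal_mul (by positivity)]
    refine ENNReal.ofReal_le_ofReal (le_of_eq ?_)
    -- The normalization to the power ρ = 1/(e+2) cancels κ^(2/(e+2)) exactly and leaves B.
    have h1 : (n : ℝ) / (c n o ^ 2 * Real.log n) = (κ ^ 2)⁻¹ := by
      rw [hκ, mul_pow, hL2]; field_simp
    rw [h1, hρ, ← Real.rpow_natCast, ← Real.rpow_neg hκ0.le, ← Real.rpow_mul hκ0.le,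
      mul_left_comm, ← Real.rpow_add hκ0,
      show -((2 : ℕ) : ℝ) * (1 / (e + 2)) + 2 / (e + 2) = 0 by push_cast; ring, Real.rpow_zero,
      mul_one]
  · refine (measure_union_le _ _).trans (add_le_add ((measure_union_le _ _).trans
      (add_le_add ((measure_union_le _ _).trans (add_le_add ?_ ?_)) ?_)) ?_)
    · exact le_iSup₂ (f := fun P (_ : P ∈ 𝓜) => sampleLaw P n
        {o | ¬ GoodDeviations ylo yhi Θ 𝒢 C (obsLaw P) o}) P hP
    · exact le_iSup₂ (f := fun P (_ : P ∈ 𝓜) => sampleLaw P n {o | K ≤ a n o}ᶜ) P hP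
    · exact le_iSup₂ (f := fun P (_ : P ∈ 𝓜) => sampleLaw P n {o | K ≤ c n o}ᶜ) P hP
    · exact le_iSup₂ (f := fun P (_ : P ∈ 𝓜) => sampleLaw P n
        {o | σ n o * ((n : ℝ) / Real.log n) ^ (ψ / 2) ≤ Mσ}ᶜ) P hP

/-! ### Informative instruments from balls -/

/-- The excess over the end of `[γl, γu]` of the conditional mean that bounds this end. -/
noncomputable def condGap {d : ℕ} (ylo yhi γl γu : ℝ) (R : Measure (Obs d)) (j : Fin 2) (o : Obs d) : ℝ :=
  if j = 0 then γl - condX R (fill ylo) o else condX R (fill yhi) o - γu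

/-- Given X, the j-th moment has conditional mean equal to the gap minus the excess, which is at
most minus half the excess wherever the instrument is nonzero. -/
theorem integral_weighted_le_of_condGap_le {d : ℕ} {ylo yhi γl γu θ : ℝ} {P : Measure (Latent d)}
    (h : IsSelectionModel ylo yhi P) {g : Euc d → Fin 2 → ℝ} (hg : Measurable g)
    (hg01 : ∀ x i, 0 ≤ g x i ∧ g x i ≤ 1) {j : Fin 2}
    (hgap : ∀ᵐ o ∂(obsLaw P), g o.X j ≠ 0 →
      condGap ylo yhi γl γu (obsLaw P) j o ≤ excess γl γu j θ / 2) :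
    ∫ o, weighted ylo yhi θ g j o ∂(obsLaw P)
      ≤ -(excess γl γu j θ / 2) * ∫ o, g o.X j ∂(obsLaw P) := by
  have := h.isProbabilityMeasure_obsLaw
  have hgm : Measurable fun x => g x j := (measurable_pi_apply j).comp hg
  have hgb : ∀ x, |g x j| ≤ 1 := fun x => by
    rw [abs_of_nonneg (hg01 x j).1]; exact (hg01 x j).2
  have hgi : Integrable (fun o : Obs d => g o.X j) (obsLaw P) :=
    Integrable.of_bound (hgm.comp measurable_X).aestronglyMeasurable 1
      (Eventually.of_forall fun o => hgb _)
  obtain ⟨el, il, il'⟩ := integral_mul_comp_X h.integrable_fill.1 hgm hgb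
  obtain ⟨eu, iu, iu'⟩ := integral_mul_comp_X h.integrable_fill.2 hgm hgb
  rw [← integral_const_mul]
  by_cases hj : j = 0
  · have e1 : ∫ o, weighted ylo yhi θ g j o ∂(obsLaw P)
        = ∫ o, (θ * g o.X j - condX (obsLaw P) (fill ylo) o * g o.X j) ∂(obsLaw P) := by
      rw [integral_sub (hgi.const_mul _) il, ← el, ← integral_sub (hgi.const_mul _) il']
      simp only [weighted, moment, hj, if_true, sub_mul]
    rw [e1]
    refine integral_mono_ae ((hgi.const_mul _).sub il) (hgi.const_mul _) (hgap.mono fun o ho => ?_)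
    simp only [condGap, excess, hj, if_true] at ho ⊢
    rcases eq_or_ne (g o.X 0) 0 with h0 | h0
    · simp [h0]
    · have h1 := ho h0
      have h2 := (hg01 o.X 0).1
      nlinarith
  · have e1 : ∫ o, weighted ylo yhi θ g j o ∂(obsLaw P)
        = ∫ o, (condX (obsLaw P) (fill yhi) o * g o.X j - θ * g o.X j) ∂(obsLaw P) := by
      rw [integral_sub iu (hgi.const_mul _), ← eu, ← integral_sub iu' (hgi.const_mul _)]
      simp only [weighted, moment, hj, if_false, sub_mul]
    rw [e1]
    refine integral_mono_ae (iu.sub (hgi.const_mul _)) (hgi.const_mul _) (hgap.mono fun o ho => ?_)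
    simp only [condGap, excess, hj, if_false] at ho ⊢
    rcases eq_or_ne (g o.X j) 0 with h0 | h0
    · simp [h0]
    · have h1 := ho h0
      have h2 := (hg01 o.X j).1
      nlinarith

/-- Balls on which a conditional mean is close to the end of the identified set, and which carry
enough mass, provide informative instruments. -/
theorem hasInformativeInstruments_of_balls {d : ℕ} {ylo yhi Y C₁ C₂ c₀ e : ℝ} {Θ : Set ℝ}
    {𝒢 : Set (Euc d → Fin 2 → ℝ)} {P : Measure (Latent d)} (h : IsSelectionModel ylo yhi P)
    (hmeas : ∀ g ∈ 𝒢, Measurable g)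
    (hY : ∀ θ ∈ Θ, ∀ g ∈ 𝒢, ∀ j, ∀ᵐ o ∂(obsLaw P), |weighted ylo yhi θ g j o| ≤ Y)
    (hC₁ : 0 < C₁) (hC₂ : 0 < C₂)
    (hrich : ∀ (s : Euc d) (t : ℝ), 0 < t → ∃ g ∈ 𝒢, ∀ x j,
      (Metric.ball s (C₂ * t)).indicator (fun _ => C₁) x ≤ g x j ∧
      g x j ≤ (Metric.ball s t).indicator (fun _ => (1 : ℝ)) x)
    {γl γu : ℝ} (hγ : γl ≤ γu) (hid : identifiedSet ylo yhi Θ P = Set.Icc γl γu)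
    (hballs : ∀ j, ∀ b, 0 < b → b ≤ 2 * (Y / C₁) + 1 → ∃ (s : Euc d) (t : ℝ), 0 < t ∧
      (∀ᵐ o ∂(obsLaw P), o.X ∈ Metric.ball s t →
        condGap ylo yhi γl γu (obsLaw P) j o ≤ b / 2) ∧
      c₀ * b ^ e ≤ (obsLaw P).real {o | o.X ∈ Metric.ball s (C₂ * t)}) :
    HasInformativeInstruments ylo yhi Θ 𝒢 (C₁ * c₀) e P := by
  have := h.isProbabilityMeasure_obsLaw
  refine ⟨γl, γu, hγ, hid, fun θ hθ j hb => ?_⟩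
  have hsub : ∀ γ ∈ Set.Icc γl γu, γ ∈ Θ := fun γ hγ => by rw [← hid] at hγ; exact hγ.1
  -- Moments at two parameters differ by exactly the difference of the parameters and are each
  -- bounded by Y/C₁, so only bounded b matter. The 1 keeps the bound positive when Y = 0.
  have hbmax : excess γl γu j θ ≤ 2 * (Y / C₁) + 1 := by
    have hdist : ∀ γ ∈ Θ, |θ - γ| ≤ 2 * (Y / C₁) := by
      intro γ hγ
      obtain ⟨o, h1, h2⟩ := ((ae_abs_moment_le hC₁ hC₂ hrich (hY θ hθ) 1).and
        (ae_abs_moment_le hC₁ hC₂ hrich (hY γ hγ) 1)).exists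
      have h3 : θ - γ = moment ylo yhi 1 γ o - moment ylo yhi 1 θ o := by simp [moment]
      rw [h3]
      exact (abs_sub _ _).trans (by linarith)
    unfold excess
    split_ifs
    · have := (abs_le.1 (hdist γl (hsub _ ⟨le_rfl, hγ⟩))).1
      linarith
    · have := (abs_le.1 (hdist γu (hsub _ ⟨hγ, le_rfl⟩))).2
      linarith
  obtain ⟨s, t, ht, hgap, hmass⟩ := hballs j _ hb hbmax
  -- The instrument vanishes off the ball of radius t, where nothing is known about the gap, and is
  -- at least C₁ on the ball of radius C₂ t, which supplies the mass.
  obtain ⟨g, hg, hgb⟩ := hrich s t ht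
  have hg01 : ∀ x i, 0 ≤ g x i ∧ g x i ≤ 1 := fun x i =>
    ⟨(Set.indicator_nonneg (fun _ _ => hC₁.le) x).trans (hgb x i).1,
      (hgb x i).2.trans (Set.indicator_le_self' (fun _ _ => zero_le_one) x)⟩
  refine ⟨g, hg, hg01, ?_, integral_weighted_le_of_condGap_le h (hmeas g hg) hg01
    (hgap.mono fun o ho h0 => ho ?_)⟩
  · have hms : MeasurableSet {o : Obs d | o.X ∈ Metric.ball s (C₂ * t)} :=
      measurable_X Metric.isOpen_ball.measurableSet
    have hgi : Integrable (fun o : Obs d => g o.X j) (obsLaw P) :=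
      Integrable.of_bound (((measurable_pi_apply j).comp
        ((hmeas g hg).comp measurable_X))).aestronglyMeasurable 1
        (Eventually.of_forall fun o => by
          rw [Real.norm_of_nonneg (hg01 _ _).1]; exact (hg01 _ _).2)
    calc C₁ * c₀ * excess γl γu j θ ^ e
        = (c₀ * excess γl γu j θ ^ e) * C₁ := by ring
      _ ≤ (obsLaw P).real {o | o.X ∈ Metric.ball s (C₂ * t)} * C₁ := by gcongr
      _ = ∫ o, {o : Obs d | o.X ∈ Metric.ball s (C₂ * t)}.indicator (fun _ => C₁) o
            ∂(obsLaw P) := by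
          rw [integral_indicator_const _ hms, smul_eq_mul]
      _ ≤ _ := by
          refine integral_mono ((integrable_const C₁).indicator hms) hgi fun o => ?_
          exact (hgb o.X j).1
  · by_contra hcon
    have h1 := (hgb o.X j).2
    rw [Set.indicator_of_notMem hcon] at h1
    exact h0 (le_antisymm h1 (hg01 _ _).1)

/-! ### Balls with enough mass in the three designs -/

theorem le_measureReal_ball_of_hasDensityGE {d : ℕ} {R : Measure (Obs d)} [IsFiniteMeasure R]
    {A : Set (Euc d)} {l : Euc d → ℝ} (h : HasDensityGE R A l) {s : Euc d} {r l₀ : ℝ}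
    (hr : 0 < r) (hsub : Metric.ball s r ⊆ A) (hl₀ : 0 ≤ l₀)
    (hl : ∀ x ∈ Metric.ball s r, l₀ ≤ l x) :
    l₀ * (r ^ d * (volume : Measure (Euc d)).real (Metric.ball 0 1))
      ≤ R.real {o | o.X ∈ Metric.ball s r} := by
  obtain ⟨f, -, hfeq, hf⟩ := h
  have hb : MeasurableSet (Metric.ball s r) := Metric.isOpen_ball.measurableSet
  have h1 : R {o | o.X ∈ Metric.ball s r} = ∫⁻ x in Metric.ball s r, f x := by
    calc R {o | o.X ∈ Metric.ball s r} = (R.map Obs.X) (Metric.ball s r) :=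
          (Measure.map_apply measurable_X hb).symm
      _ = (R.map Obs.X).restrict A (Metric.ball s r) :=
          (Measure.restrict_eq_self _ hsub).symm
      _ = _ := by
          rw [hfeq, withDensity_apply _ hb, Measure.restrict_restrict hb,
            Set.inter_eq_left.2 hsub]
  have h2 : ENNReal.ofReal l₀ * volume (Metric.ball s r) ≤ ∫⁻ x in Metric.ball s r, f x := by
    rw [← setLIntegral_const]
    exact setLIntegral_mono' hb fun x hx =>
      (ENNReal.ofReal_le_ofReal (hl x hx)).trans (hf x (hsub hx))
  rw [← h1, Measure.addHaar_ball_of_pos _ _ hr, finrank_euclideanSpace_fin] at h2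
  have h3 := ENNReal.toReal_mono (by finiteness) h2
  rw [ENNReal.toReal_mul, ENNReal.toReal_mul, ENNReal.toReal_ofReal hl₀,
    ENNReal.toReal_ofReal (by positivity)] at h3
  exact h3

theorem measureReal_unitBall_pos (d : ℕ) :
    0 < (volume : Measure (Euc d)).real (Metric.ball 0 1) :=
  ENNReal.toReal_pos (Metric.measure_ball_pos _ _ one_pos).ne' (by finiteness)

/-- The power is increasing or decreasing according to the sign of φ, so the minimum over both ends
serves either case. The density exponent φx may be negative. -/
theorem min_rpow_mul_le_rpow {p q h u φ : ℝ} (hp : 0 < p) (hh : 0 < h) (h1 : p * h ≤ u)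
    (h2 : u ≤ q * h) : min (p ^ φ) (q ^ φ) * h ^ φ ≤ u ^ φ := by
  have hu : 0 < u := lt_of_lt_of_le (by positivity) h1
  rcases le_total 0 φ with hφ | hφ
  · refine (mul_le_mul_of_nonneg_right (min_le_left _ _) (by positivity)).trans ?_
    rw [← Real.mul_rpow hp.le hh.le]
    exact Real.rpow_le_rpow (by positivity) h1 hφ
  · have hq : 0 < q := by
      by_contra hcon
      nlinarith
    refine (mul_le_mul_of_nonneg_right (min_le_right _ _) (by positivity)).trans ?_
    rw [← Real.mul_rpow hq.le hh.le]
    exact Real.rpow_le_rpow_of_nonpos hu h2 hφ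

/-- The corner of a box at `x₀` contains balls with polynomial mass near `x₀`. -/
theorem exists_ball_of_corner {d : ℕ} {φm φx C η C₂ b₁ : ℝ} (hφm : 0 < φm) (hC : 0 < C)
    (hη : 0 < η) (hC₂ : 0 < C₂) (hC₂' : C₂ < 1) (hb₁ : 0 < b₁) :
    ∃ c₀ : ℝ, 0 < c₀ ∧ ∀ (R : Measure (Obs d)) [IsFiniteMeasure R] (x₀ : Euc d) (gap : Obs d → ℝ),
      (∀ᵐ o ∂(R), o.X ∈ {x : Euc d | ∀ k, x₀ k - η ≤ x k ∧ x k ≤ x₀ k} →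
        gap o ≤ C * ‖x₀ - o.X‖ ^ φm) →
      HasDensityGE R {x : Euc d | ∀ k, x₀ k - η ≤ x k ∧ x k ≤ x₀ k}
        (fun x => (∏ k, |x₀ k - x k| ^ φx) / C) →
      ∀ b, 0 < b → b ≤ b₁ → ∃ (s : Euc d) (t : ℝ), 0 < t ∧
        (∀ᵐ o ∂(R), o.X ∈ Metric.ball s t → gap o ≤ b / 2) ∧
        c₀ * b ^ (d * (φx + 1) / φm) ≤ R.real {o | o.X ∈ Metric.ball s (C₂ * t)} := by
  set one : Euc d := WithLp.toLp 2 fun _ => 1 with hone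
  set q := ‖one‖ + 1 with hq
  have hq0 : 0 < q := by positivity
  -- The scale is h = lam b^(1/φm). The first entry makes the gap at most b/2 within distance q h of
  -- x₀; the second keeps h ≤ η for all b ≤ b₁.
  set lam := min ((2 * C * q ^ φm) ^ (-(1 / φm))) (η * b₁ ^ (-(1 / φm))) with hlam
  have hlam0 : 0 < lam := by positivity
  set m := min (((1 - C₂) / 2) ^ φx) (((1 + C₂) / 2) ^ φx) with hm
  have h1C : 0 < 1 - C₂ := by linarith
  have hm0 : 0 < m := by positivity
  set v := (volume : Measure (Euc d)).real (Metric.ball 0 1) with hv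
  have hv0 : 0 < v := measureReal_unitBall_pos d
  refine ⟨m ^ d / C * ((C₂ / 2) ^ d * v) * lam ^ (d * (φx + 1)), by positivity,
    fun R _ x₀ gap hgap hdens b hb hbb => ?_⟩
  set h := lam * b ^ (1 / φm) with hh
  have hh0 : 0 < h := by positivity
  have hhη : h ≤ η := by
    calc h ≤ η * b₁ ^ (-(1 / φm)) * b₁ ^ (1 / φm) := by
          rw [hh]
          gcongr
          exact min_le_right _ _
      _ = η := by
          rw [mul_assoc, ← Real.rpow_add hb₁, neg_add_cancel, Real.rpow_zero, mul_one]
  have hhm : C * (q * h) ^ φm ≤ b / 2 := by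
    have h1 : lam ^ φm ≤ (2 * C * q ^ φm)⁻¹ := by
      calc lam ^ φm ≤ ((2 * C * q ^ φm) ^ (-(1 / φm))) ^ φm := by
            gcongr
            exact min_le_left _ _
        _ = _ := by
            rw [← Real.rpow_mul (by positivity), neg_mul, one_div_mul_cancel hφm.ne',
              Real.rpow_neg_one]
    rw [hh, Real.mul_rpow hq0.le (by positivity), Real.mul_rpow hlam0.le (by positivity),
      ← Real.rpow_mul hb.le, one_div_mul_cancel hφm.ne', Real.rpow_one]
    calc C * (q ^ φm * (lam ^ φm * b)) ≤ C * (q ^ φm * ((2 * C * q ^ φm)⁻¹ * b)) := by gcongr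
      _ = b / 2 := by field_simp
  -- The ball of radius h/2 about s stays in the corner box. In the smaller ball each coordinate is
  -- at distance between (1 - C₂)h/2 and (1 + C₂)h/2 from that of x₀, so the density is of order at
  -- least h^(d φx) and the mass h^(d(φx+1)).
  set s : Euc d := x₀ - (h / 2) • one with hs
  have hsk : ∀ k, s k = x₀ k - h / 2 := fun k => by simp [hs, hone]
  have hcoord : ∀ (r : ℝ), ∀ x ∈ Metric.ball s r, ∀ k, |x k - (x₀ k - h / 2)| < r := by
    intro r x hx k
    have h1 := PiLp.norm_apply_le (x - s) k
    rw [PiLp.sub_apply, hsk, Real.norm_eq_abs] at h1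
    exact h1.trans_lt (by rwa [mem_ball_iff_norm] at hx)
  have hsub : Metric.ball s (h / 2) ⊆ {x : Euc d | ∀ k, x₀ k - η ≤ x k ∧ x k ≤ x₀ k} := by
    intro x hx k
    have := abs_lt.1 (hcoord _ x hx k)
    constructor <;> linarith
  refine ⟨s, h / 2, by positivity, ?_, ?_⟩
  · refine hgap.mono fun o ho hx => (ho (hsub hx)).trans (le_trans ?_ hhm)
    gcongr
    have h1 : x₀ - o.X = (h / 2) • one - (o.X - s) := by rw [hs]; abel
    rw [h1]
    refine (norm_sub_le _ _).trans ?_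
    rw [norm_smul, Real.norm_of_nonneg (by positivity)]
    rw [mem_ball_iff_norm] at hx
    have : 0 ≤ h * ‖one‖ := by positivity
    rw [hq]
    linarith
  · have hrad : C₂ * (h / 2) ≤ h / 2 := by nlinarith
    refine le_trans (le_of_eq ?_) (le_measureReal_ball_of_hasDensityGE hdens
      (by positivity) ((Metric.ball_subset_ball hrad).trans hsub)
      (l₀ := (m * h ^ φx) ^ d / C) (by positivity) fun x hx => ?_)
    · rw [← hv]
      have e1 : lam ^ (d * (φx + 1)) * b ^ (d * (φx + 1) / φm) = (h ^ φx) ^ d * h ^ d := by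
        have e2 : h ^ φx * h = h ^ (φx + 1) := by rw [Real.rpow_add hh0, Real.rpow_one]
        rw [← mul_pow, e2, ← Real.rpow_natCast, ← Real.rpow_mul hh0.le, hh,
          Real.mul_rpow hlam0.le (by positivity), ← Real.rpow_mul hb.le]
        congr 2
        · ring
        · ring
      calc _ = m ^ d / C * ((C₂ / 2) ^ d * v) *
            (lam ^ (d * (φx + 1)) * b ^ (d * (φx + 1) / φm)) := by ring
        _ = _ := by
            rw [e1, mul_pow, show C₂ * (h / 2) = C₂ / 2 * h by ring, mul_pow]
            ring
    · gcongr
      have : (m * h ^ φx) ^ d = ∏ _k : Fin d, (m * h ^ φx) := by simp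
      rw [this]
      refine Finset.prod_le_prod (fun k _ => by positivity) fun k _ => ?_
      have hk := abs_lt.1 (hcoord _ x hx k)
      have hpos : 0 ≤ x₀ k - x k := by linarith
      rw [abs_of_nonneg hpos]
      exact min_rpow_mul_le_rpow (by positivity) hh0 (by linarith) (by linarith)

/-- A polynomial tail contains balls with polynomial mass near infinity. -/
theorem exists_ball_of_tail {φm φx C KX C₂ b₁ : ℝ} (hφm : 0 < φm) (hφx : 1 < φx) (hC : 0 < C)
    (hC₂ : 0 < C₂) (hC₂' : C₂ < 1) (hb₁ : 0 < b₁) (i : Fin 1) :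
    ∃ c₀ : ℝ, 0 < c₀ ∧ ∀ (R : Measure (Obs 1)) [IsFiniteMeasure R] (gap : Obs 1 → ℝ),
      (∀ᵐ o ∂(R), KX ≤ o.X i → gap o ≤ C * (o.X i) ^ (-φm)) →
      HasDensityGE R {x : Euc 1 | KX ≤ x i} (fun x => (x i) ^ (-φx) / C) →
      ∀ b, 0 < b → b ≤ b₁ → ∃ (s : Euc 1) (t : ℝ), 0 < t ∧
        (∀ᵐ o ∂(R), o.X ∈ Metric.ball s t → gap o ≤ b / 2) ∧
        c₀ * b ^ ((φx - 1) / φm) ≤ R.real {o | o.X ∈ Metric.ball s (C₂ * t)} := by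
  -- Here h = lam b^(-1/φm) must be large: the first entry makes the gap at most b/2 beyond h, the
  -- second ensures h ≥ KX for all b ≤ b₁.
  set lam := max ((2 * C) ^ (1 / φm)) (KX * b₁ ^ (1 / φm)) with hlam
  have hlam0 : 0 < lam := lt_max_of_lt_left (by positivity)
  set v := (volume : Measure (Euc 1)).real (Metric.ball 0 1) with hv
  have hv0 : 0 < v := measureReal_unitBall_pos 1
  refine ⟨2 ^ (-φx) / C * (C₂ / 2 * v) * lam ^ (1 - φx), by positivity,
    fun R _ gap hgap hdens b hb hbb => ?_⟩
  set h := lam * b ^ (-(1 / φm)) with hh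
  have hh0 : 0 < h := by positivity
  have hhK : KX ≤ h := by
    calc KX = KX * b₁ ^ (1 / φm) * b₁ ^ (-(1 / φm)) := by
          rw [mul_assoc, ← Real.rpow_add hb₁, add_neg_cancel, Real.rpow_zero, mul_one]
      _ ≤ lam * b ^ (-(1 / φm)) := by
          refine mul_le_mul (le_max_right _ _) ?_ (by positivity) hlam0.le
          exact Real.rpow_le_rpow_of_nonpos hb hbb (by simp only [Left.neg_nonpos_iff]; positivity)
  have hhm : C * h ^ (-φm) ≤ b / 2 := by
    have h1 : lam ^ (-φm) ≤ (2 * C)⁻¹ := by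
      calc lam ^ (-φm) ≤ ((2 * C) ^ (1 / φm)) ^ (-φm) :=
            Real.rpow_le_rpow_of_nonpos (by positivity) (le_max_left _ _) (by linarith)
        _ = _ := by
            rw [← Real.rpow_mul (by positivity), mul_neg, one_div_mul_cancel hφm.ne',
              Real.rpow_neg_one]
    rw [hh, Real.mul_rpow hlam0.le (by positivity), ← Real.rpow_mul hb.le, neg_mul_neg,
      one_div_mul_cancel hφm.ne', Real.rpow_one]
    calc C * (lam ^ (-φm) * b) ≤ C * ((2 * C)⁻¹ * b) := by gcongr
      _ = b / 2 := by field_simp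
  -- The ball of radius h/2 lies between h and 2h, where the density is at least (2h)^(-φx)/C; the
  -- mass is of order at least h^(1-φx).
  set s : Euc 1 := WithLp.toLp 2 fun _ => 3 * h / 2 with hs
  have hcoord : ∀ x ∈ Metric.ball s (h / 2), h ≤ x i ∧ x i ≤ 2 * h := by
    intro x hx
    have h1 := PiLp.norm_apply_le (x - s) i
    rw [PiLp.sub_apply, Real.norm_eq_abs] at h1
    have h2 := abs_lt.1 (h1.trans_lt (by rwa [mem_ball_iff_norm] at hx))
    have h3 : s i = 3 * h / 2 := by simp [hs]
    rw [h3] at h2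
    constructor <;> linarith
  have hsub : Metric.ball s (h / 2) ⊆ {x : Euc 1 | KX ≤ x i} :=
    fun x hx => hhK.trans (hcoord x hx).1
  refine ⟨s, h / 2, by positivity, ?_, ?_⟩
  · refine hgap.mono fun o ho hx => (ho (hsub hx)).trans (le_trans ?_ hhm)
    exact mul_le_mul_of_nonneg_left
      (Real.rpow_le_rpow_of_nonpos hh0 (hcoord _ hx).1 (neg_nonpos.2 hφm.le)) hC.le
  · have hrad : C₂ * (h / 2) ≤ h / 2 := by nlinarith
    refine le_trans (le_of_eq ?_) (le_measureReal_ball_of_hasDensityGE hdens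
      (by positivity) ((Metric.ball_subset_ball hrad).trans hsub)
      (l₀ := (2 * h) ^ (-φx) / C) (by positivity) fun x hx => ?_)
    · rw [← hv]
      have e1 : lam ^ (1 - φx) * b ^ ((φx - 1) / φm) = h ^ (-φx) * h := by
        nth_rw 2 [← Real.rpow_one h]
        rw [← Real.rpow_add hh0, hh,
          Real.mul_rpow hlam0.le (by positivity), ← Real.rpow_mul hb.le]
        congr 2
        · ring
        · ring
      calc _ = 2 ^ (-φx) / C * (C₂ / 2 * v) * (lam ^ (1 - φx) * b ^ ((φx - 1) / φm)) := by ring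
        _ = _ := by
            rw [e1, Real.mul_rpow zero_le_two hh0.le]
            ring
    · have hx' := hcoord x (Metric.ball_subset_ball hrad hx)
      exact div_le_div_of_nonneg_right
        (Real.rpow_le_rpow_of_nonpos (hh0.trans_le hx'.1) hx'.2 (by linarith)) hC.le

/-- A box with positive probability contains balls with probability bounded away from zero. -/
theorem exists_ball_of_box {d : ℕ} (l u : Euc d) {η p C₂ : ℝ} (hη : 0 < η) (hp : 0 < p)
    (hC₂ : 0 < C₂) :
    ∃ c₀ : ℝ, 0 < c₀ ∧ ∀ (R : Measure (Obs d)) [IsFiniteMeasure R],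
      ENNReal.ofReal p ≤ R {o | ∀ k, l k + η ≤ o.X k ∧ o.X k ≤ u k - η} →
      ∃ s : Euc d, Metric.ball s η ⊆ {x | ∀ k, l k ≤ x k ∧ x k ≤ u k} ∧
        c₀ ≤ R.real {o | o.X ∈ Metric.ball s (C₂ * η)} := by
  set I : Set (Euc d) := {x | ∀ k, l k + η ≤ x k ∧ x k ≤ u k - η} with hI
  have hcomp : IsCompact I := by
    have h1 : IsCompact (Set.Icc (fun k => l k + η) (fun k => u k - η)) := isCompact_Icc
    have h2 : I = (EuclideanSpace.equiv (Fin d) ℝ).toHomeomorph ⁻¹'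
        Set.Icc (fun k => l k + η) (fun k => u k - η) := by
      ext x
      simp only [hI, Set.mem_preimage, Set.mem_Icc, Pi.le_def, ← forall_and]
      rfl
    rw [h2, Homeomorph.isCompact_preimage]
    exact h1
  -- The cover depends on the box only, so pigeonhole gives a mass bound uniform in R. Centers lie
  -- in the inner box, hence their η-balls stay in the outer one.
  obtain ⟨t, htI, htf, hcov⟩ := hcomp.finite_cover_balls (e := C₂ * η) (by positivity)
  set T := htf.toFinset with hT
  refine ⟨p / (T.card + 1), by positivity, fun R _ hR => ?_⟩
  have h1 : p ≤ ∑ s ∈ T, R.real {o | o.X ∈ Metric.ball s (C₂ * η)} := by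
    rw [ENNReal.ofReal_le_iff_le_toReal (by finiteness)] at hR
    refine hR.trans ((measureReal_mono ?_ (measure_ne_top _ _)).trans (measureReal_biUnion_finset_le _ _))
    intro o ho
    obtain ⟨s, hs, hos⟩ := Set.mem_iUnion₂.1 (hcov (show o.X ∈ I from ho))
    exact Set.mem_iUnion₂.2 ⟨s, by simpa [hT] using hs, hos⟩
  obtain ⟨s, hs, hle⟩ : ∃ s ∈ T, p / (T.card + 1) ≤ R.real {o | o.X ∈ Metric.ball s (C₂ * η)} := by
    by_contra hcon
    push Not at hcon
    have h2 := h1.trans (Finset.sum_le_sum fun s hs => (hcon s hs).le)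
    rw [Finset.sum_const, nsmul_eq_mul, mul_div_assoc', le_div_iff₀ (by positivity)] at h2
    nlinarith
  have hsI : s ∈ I := htI (by simpa [hT] using hs)
  refine ⟨s, fun x hx k => ?_, hle⟩
  have h2 := PiLp.norm_apply_le (x - s) k
  rw [PiLp.sub_apply, Real.norm_eq_abs] at h2
  have h3 := abs_lt.1 (h2.trans_lt (by rwa [mem_ball_iff_norm] at hx))
  have h4 := hsI k
  constructor <;> linarith

end SelectionKS

/-! ### Assembly of the three rates -/

theorem mainTheorem8 (V Ybar KS₁ : ℝ) (hV : 0 < V) (hYbar : 0 ≤ Ybar) (hKS₁ : 0 < KS₁) :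
    ∃ K₀ : ℝ, 0 < K₀ ∧
    ∀ (d : ℕ) (ylo yhi : ℝ) (Θ : Set ℝ) (𝓜 : Set (Measure (SelectionKS.Latent d)))
      (𝒢 : Set (SelectionKS.Euc d → Fin 2 → ℝ)) (S : (Fin 2 → ℝ) → ℝ)
      (σ a c : ∀ n : ℕ, (Fin n → SelectionKS.Obs d) → ℝ) (A KS₂ K : ℝ),
      0 < A → 0 < KS₂ → K₀ ≤ K →
      (∀ P ∈ 𝓜, SelectionKS.IsSelectionModel ylo yhi P) →
      SelectionKS.PointwiseMeasurable 𝒢 →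
      SelectionKS.NonnegInstruments 𝓜 𝒢 →
      SelectionKS.BoundedMoments ylo yhi Θ 𝓜 𝒢 Ybar →
      SelectionKS.PolynomialCovering ylo yhi Θ 𝒢 Ybar A V →
      SelectionKS.SCondition S KS₁ KS₂ →
      SelectionKS.CutoffCondition 𝓜 σ a →
      SelectionKS.UnifProbToOne 𝓜 (fun n => {o | K ≤ a n o}) →
      SelectionKS.UnifProbToOne 𝓜 (fun n => {o | K ≤ c n o}) →
      SelectionKS.RichInstruments 𝒢 →
      -- identification at a finite point
      (∀ φm φx C η : ℝ, 0 < φm → -1 < φx → 0 < C → 0 < η →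
        (∀ P ∈ 𝓜, SelectionKS.IdentFinite ylo yhi Θ φm φx C η P) →
        ∀ α : ℝ, α = φm / (φx + 1) →
        SelectionKS.CutoffRate 𝓜 σ (d / (d + 2 * α)) →
        SelectionKS.ConvergesAtRate ylo yhi Θ 𝓜 𝒢 S σ c (α / (d + 2 * α))) ∧
      -- identification at infinity
      (d = 1 → ∀ (i : Fin d) (φm φx C KX : ℝ), 0 < φm → 1 < φx → 0 < C → 0 < KX →
        (∀ P ∈ 𝓜, SelectionKS.IdentInfinity ylo yhi Θ i φm φx C KX P) →
        ∀ α : ℝ, α = φm / (φx - 1) →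
        SelectionKS.CutoffRate 𝓜 σ (d / (d + 2 * α)) →
        SelectionKS.ConvergesAtRate ylo yhi Θ 𝓜 𝒢 S σ c (α / (d + 2 * α))) ∧
      -- identification on a set of positive probability
      (∀ (lH uH lL uL : SelectionKS.Euc d) (η p : ℝ), 0 < η → 0 < p →
        (∀ P ∈ 𝓜, SelectionKS.IdentPositive ylo yhi Θ lH uH lL uL η p P) →
        SelectionKS.ConvergesAtRate ylo yhi Θ 𝓜 𝒢 S σ c (1 / 2)) := by
  obtain ⟨C, hC0, hC⟩ := SelectionKS.tendsto_iSup_not_goodDeviations (Y := Ybar) hV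
  -- K ≥ 1 yields σ_n ≥ L and c_n ≥ 1; the second entry makes √(2C) < K K_{S,1}, as coverage
  -- requires.
  refine ⟨max 1 ((√(2 * C) + 1) / KS₁), by positivity, ?_⟩
  intro d ylo yhi Θ 𝓜 𝒢 S σ a c A KS₂ K hA hKS₂ hK hmod hpm hnonneg hbm hpc hS hcut ha hc hrich
  have hK1 : 1 ≤ K := (le_max_left _ _).trans hK
  have hK2 : √(2 * C) < K * KS₁ := by
    have := (le_max_right _ _).trans hK
    rw [div_le_iff₀ hKS₁] at this
    linarith
  have hgood := hC d ylo yhi Θ 𝓜 𝒢 A hA hmod hpm hbm hpc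
  have hmeas := hpm.1
  have main : ∀ (c₀ e ρ ψ : ℝ), 0 ≤ e → ρ = 1 / (e + 2) → ψ = e / (e + 2) → 0 < c₀ →
      (∀ P ∈ 𝓜, SelectionKS.HasInformativeInstruments ylo yhi Θ 𝒢 c₀ e P) →
      SelectionKS.CutoffRate 𝓜 σ ψ → SelectionKS.ConvergesAtRate ylo yhi Θ 𝓜 𝒢 S σ c ρ :=
    fun c₀ e ρ ψ he hρ hψ hc₀ hinf hrate =>
      SelectionKS.convergesAtRate_of_hasInformativeInstruments hYbar hKS₁ hKS₂ hC0.le hK1 hK2 hmod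
        hmeas hnonneg hbm hS hcut.2 ha hc hrich hgood he hρ hψ hc₀ hinf hrate
  obtain ⟨C₁, C₂, hC₁, -, hC₂, hC₂', hballs⟩ := hrich.2
  have hb₁ : 0 < 2 * (Ybar / C₁) + 1 := by positivity
  refine ⟨?_, ?_, ?_⟩
  · intro φm φx D η hφm hφx hD hη hid α hα hrate
    obtain ⟨c₀, hc₀, hcorner⟩ := SelectionKS.exists_ball_of_corner (d := d) (φx := φx) hφm hD hη
      hC₂ hC₂' hb₁
    have hφx1 : 0 < φx + 1 := by linarith
    have hα0 : 0 < α := by rw [hα]; positivity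
    have he : (d : ℝ) * (φx + 1) / φm = d / α := by rw [hα]; field_simp
    refine main (C₁ * c₀) (d * (φx + 1) / φm) _ _ (by positivity) ?_ ?_ (by positivity)
      (fun P hP => ?_) hrate
    · rw [he]; field_simp
    · rw [he]; field_simp
    have := (hmod P hP).isProbabilityMeasure_obsLaw
    obtain ⟨γl, γu, hγ, hidP, ⟨xu, hu, hdu⟩, ⟨xl, hl, hdl⟩⟩ := hid P hP
    refine SelectionKS.hasInformativeInstruments_of_balls (hmod P hP) hmeas (hbm P hP) hC₁ hC₂
      hballs hγ hidP fun j => ?_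
    fin_cases j
    · exact hcorner _ xl _ hl hdl
    · exact hcorner _ xu _ hu hdu
  · rintro rfl i φm φx D KX hφm hφx hD - hid α hα hrate
    obtain ⟨c₀, hc₀, htail⟩ := SelectionKS.exists_ball_of_tail hφm hφx hD hC₂ hC₂' hb₁ i
    have hφx1 : 0 < φx - 1 := by linarith
    have hα0 : 0 < α := by rw [hα]; positivity
    have he : (φx - 1) / φm = 1 / α := by rw [hα]; field_simp
    refine main (C₁ * c₀) ((φx - 1) / φm) _ _ (by positivity) ?_ ?_ (by positivity)
      (fun P hP => ?_) hrate
    · rw [he, Nat.cast_one]; field_simp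
    · rw [he, Nat.cast_one]; field_simp
    have := (hmod P hP).isProbabilityMeasure_obsLaw
    obtain ⟨γl, γu, hγ, hidP, hu, hl, hdens⟩ := hid P hP
    refine SelectionKS.hasInformativeInstruments_of_balls (hmod P hP) hmeas (hbm P hP) hC₁ hC₂
      hballs hγ hidP fun j => ?_
    fin_cases j
    · exact htail _ _ hl hdens
    · exact htail _ _ hu hdens
  · intro lH uH lL uL η p hη hp hid
    obtain ⟨cH, hcH, hboxH⟩ := SelectionKS.exists_ball_of_box lH uH hη hp hC₂
    obtain ⟨cL, hcL, hboxL⟩ := SelectionKS.exists_ball_of_box lL uL hη hp hC₂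
    obtain ⟨M, hM⟩ := hcut.1
    -- With e = 0 the cutoff exponent is 0, so the rate condition reduces to the boundedness of σ_n
    -- already assumed.
    refine main (C₁ * min cH cL) 0 _ 0 le_rfl (by norm_num) (by norm_num)
      (mul_pos hC₁ (lt_min hcH hcL)) (fun P hP => ?_) ⟨M, by simpa using hM⟩
    have := (hmod P hP).isProbabilityMeasure_obsLaw
    obtain ⟨γl, γu, hγ, hidP, hu, hpu, hl, hpl⟩ := hid P hP
    refine SelectionKS.hasInformativeInstruments_of_balls (hmod P hP) hmeas (hbm P hP) hC₁ hC₂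
      hballs hγ hidP fun j b hb _ => ?_
    simp only [Real.rpow_zero, mul_one]
    fin_cases j
    · obtain ⟨s, hs, hmass⟩ := hboxL _ hpl
      exact ⟨s, η, hη, hl.mono fun o ho hx => (ho (hs hx)).le.trans (by positivity),
        (min_le_right _ _).trans hmass⟩
    · obtain ⟨s, hs, hmass⟩ := hboxH _ hpu
      exact ⟨s, η, hη, hu.mono fun o ho hx => (ho (hs hx)).le.trans (by positivity),
        (min_le_left _ _).trans hmass⟩
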